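/- Let $X$ be a smooth $n$-dimensional manifold (without boundary), oriented by a smooth volume form $\Omega>0$, and let $K$ be a smooth section of $\mathrm{End}(T_X)$ with $n$ distinct real eigenvalues at almost every point of $X$. Let $\mathcal M$ be the set of smooth Riemannian metrics on $X$. For $g\in\mathcal M$, with Levi-Civita connection $\nabla_g$ and curvature tensor $\mathcal R_g$, put $f_g:=\log\frac{dV_g}{\Omega}$ and $$\mathrm{Ric}_g(\Omega):=\mathrm{Ric}(g)+\nabla_g\, d f_g,\qquad \mathrm{Ric}^*_g(\Omega):=g^{-1}\mathrm{Ric}_g(\Omega),\qquad \Delta^\Omega_g:=-\mathrm{Tr}_g\nabla_g^2+\nabla_{g,\nabla_g f_g}\ \text{ on tensors.}$$ For $A\in C^\infty(X,\mathrm{End}(T_X))$ let $\nabla_{T_X,g}A(\xi,\eta):=(\nabla_{g,\xi}A)\eta-(\nabla_{g,\eta}A)\xi$. Let $\mathbb F^K_g$ be the space of smooth symmetric $2$-tensors $v$ such that $\nabla_{T_X,g}(g^{-1}v)=0$ and $[\nabla^p_gT,g^{-1}v]=0$ for $T=K$, $T=\mathcal R_g$ and all integers $p\ge 0$ (for $T=\mathcal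 R_g$ the bracket is that of the endomorphisms $(\nabla_g^p\mathcal R_g)(\xi_1,\dots,\xi_p,\xi,\eta)$ with $g^{-1}v$). Fix $g_0\in\mathcal M$ and set $\Sigma_K(g_0):=\mathbb F^K_{g_0}\cap\mathcal M$. (1) For every $g\in\Sigma_K(g_0)$, $$\mathrm{Ric}_g(\Omega)=\mathrm{Ric}_{g_0}(\Omega)-\tfrac12\,\Delta^\Omega_{g_0}\big[g_0\log(g_0^{-1}g)\big]-\tfrac14\,g_0\,\mathrm{Tr}_{g_0}\big[\nabla_{g_0,\bullet}\log(g_0^{-1}g)\,\nabla_{g_0,\bullet}\log(g_0^{-1}g)\big].$$ (2) For every $g\in\Sigma_K(g_0)$, with $H=H_g:=(g^{-1}g_0)^{1/2}$, $$\mathrm{Ric}^*_g(\Omega)=H\,\Delta^\Omega_{g_0}H+H^2\,\mathrm{Ric}^*_{g_0}(\Omega).$$ (3) The map $g\mapsto H_g$ is a bijection of $\Sigma_K(g_0)$ onto $g_0^{-1}\Sigma_K(g_0)$. Let $0<T\le\infty$ and let $(g_t)_{t\in[0,T)}$ be a family of metrics in $\Sigma_K(g_0)$, with $H_t:=H_{g_t}$.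 Then $(g_t)$ is an $\Omega$-Soliton-Ricci flow, i.e. a smooth family (in $(t,x)$) with $\nabla_{T_X,g_t}\mathrm{Ric}^*_{g_t}(\Omega)=0$ and $$\dot g_t=\mathrm{Ric}_{g_t}(\Omega)-g_t\qquad\text{on }[0,T),$$ if and only if $(H_t)$ is a smooth solution on $[0,T)$ of $$2\dot H_t=-H_t^2\,\Delta^\Omega_{g_0}H_t-H_t^3\,\mathrm{Ric}^*_{g_0}(\Omega)+H_t .$$ Moreover the metric at time $0$ is $g_0$ if and only if $H_{t=0}=\mathbb I$. -/

import Mathlib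

open Set Bundle Manifold
open scoped Manifold ContDiff Topology

set_option maxSynthPendingDepth 3

noncomputable section

namespace SolitonRicci

/-! ### Linear algebra -/

section LinearAlgebra

variable {V : Type*} [AddCommGroup V] [Module ℝ V] [TopologicalSpace V]
  [IsTopologicalAddGroup V] [ContinuousSMul ℝ V]

/-- For a scalar product `g` and a bilinear form `v` on `V`, the endomorphism `g⁻¹ v`, that is
`g (g⁻¹ v ξ, η) = v (ξ, η)`. -/
def sharp (g v : V →L[ℝ] V →L[ℝ] ℝ) : V →L[ℝ] V := g.inverse ∘L v

/-- The functional calculus `φ(B)` of an endomorphism `B` which is diagonalizable over `ℝ`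
(for instance symmetric for some scalar product): `φ(B)` is multiplication by `φ(c)` on the
eigenspace of `B` with eigenvalue `c`. It is the value at `B` of the polynomial which interpolates
`φ` at the eigenvalues of `B`. -/
def funCalc (φ : ℝ → ℝ) (B : V →L[ℝ] V) : V →L[ℝ] V :=
  Polynomial.aeval B
    (Lagrange.interpolate (minpoly ℝ (B : V →ₗ[ℝ] V)).roots.toFinset id φ)

end LinearAlgebra

/-! ### Riemannian geometry in coordinates

Here `E` is a finite dimensional real vector space, in which the charts take their values. A tensor
field is given by its coordinate expression: a function on `E` with values in a space `F` of
tensors. The value at a point of each of the expressions below depends only on the germs at this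
point of the functions in it. -/

section Coordinates

variable {E : Type} [NormedAddCommGroup E] [NormedSpace ℝ E]
  {F : Type} [NormedAddCommGroup F] [NormedSpace ℝ F]

/-- The Christoffel symbol `Γ ξ η` of the Levi-Civita connection of `g`:
`2 g (Γ ξ η, ζ) = (D_ξ g) (η, ζ) + (D_η g) (ξ, ζ) - (D_ζ g) (ξ, η)`. -/
def christoffel (g : E → E →L[ℝ] E →L[ℝ] ℝ) (y : E) : E →L[ℝ] E →L[ℝ] E :=
  let dg := fderiv ℝ g y
  let swap : (E →L[ℝ] E →L[ℝ] ℝ) →L[ℝ] (E →L[ℝ] E →L[ℝ] ℝ) :=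
    (ContinuousLinearMap.flipₗᵢ ℝ E E ℝ).toContinuousLinearEquiv
  (1 / 2 : ℝ) • (ContinuousLinearMap.compL ℝ E (E →L[ℝ] ℝ) E (g y).inverse) ∘L
    (dg + dg.flip - swap ∘L dg.flip)

/-- The action of `gl(E)` by derivations on the tensors of type `F`, which determines the zeroth
order term of the covariant derivative. It is given below for scalars, for vectors and for
`Hom (E, F)`; this covers all the tensors in use. -/
abbrev TensorAction (E F : Type) [NormedAddCommGroup E] [NormedSpace ℝ E]
    [NormedAddCommGroup F] [NormedSpace ℝ F] : Type :=
  (E →L[ℝ] E) →L[ℝ] F →L[ℝ] F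

variable (E) in
/-- The trivial action on scalars. -/
def actR : TensorAction E ℝ := 0

variable (E) in
/-- The natural action on vectors. -/
def actV : TensorAction E E := ContinuousLinearMap.id ℝ (E →L[ℝ] E)

/-- The action `L · B = ρ(L) ∘ B - B ∘ L` on `Hom (E, F)`, for a given action `ρ` on `F`. -/
def actHom (ρ : TensorAction E F) : TensorAction E (E →L[ℝ] F) :=
  (ContinuousLinearMap.compL ℝ E F F) ∘L ρ - (ContinuousLinearMap.compL ℝ E E F).flip

variable (E) in
/-- The action `L · A = L A - A L` on endomorphisms. -/
abbrev actEnd : TensorAction E (E →L[ℝ] E) := actHom (actV E)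

variable (E) in
/-- The action `(L · v) (ξ, η) = - v (L ξ, η) - v (ξ, L η)` on bilinear forms. -/
abbrev actBil : TensorAction E (E →L[ℝ] E →L[ℝ] ℝ) := actHom (actHom (actR E))

/-- The covariant derivative `∇_g A` of a tensor field: `∇_{g,ξ} A = D_ξ A + ρ(Γ_ξ) A`. -/
def cov (ρ : TensorAction E F) (g : E → E →L[ℝ] E →L[ℝ] ℝ) (A : E → F) (y : E) : E →L[ℝ] F :=
  fderiv ℝ A y + (ρ.flip (A y)) ∘L (christoffel g y)

/-- The value `(∇_g^p A) (ξ₁, …, ξ_p)` of the iterated covariant derivative of a tensor field. -/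
def iterCov (g : E → E →L[ℝ] E →L[ℝ] ℝ) : (p : ℕ) → {F : Type} → [NormedAddCommGroup F] →
    [NormedSpace ℝ F] → TensorAction E F → (E → F) → E → (Fin p → E) → F
  | 0, _, _, _, _, A, y, _ => A y
  | p + 1, _, _, _, ρ, A, y, ξ =>
      iterCov g p (actHom ρ) (cov ρ g A) y (Fin.init ξ) (ξ (Fin.last p))

/-- The covariant exterior derivative `∇_{T_X,g} A` of a section `A` of `End T_X`, considered as a
`T_X`-valued 1-form: `(ξ, η) ↦ (∇_{g,ξ} A) η - (∇_{g,η} A) ξ`. -/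
def extCov (g : E → E →L[ℝ] E →L[ℝ] ℝ) (A : E → E →L[ℝ] E) (y ξ η : E) : E :=
  cov (actEnd E) g A y ξ η - cov (actEnd E) g A y η ξ

/-- The curvature tensor `R_g (ξ, η) = D_ξ Γ_η - D_η Γ_ξ + [Γ_ξ, Γ_η]`. -/
def curvature (g : E → E →L[ℝ] E →L[ℝ] ℝ) (y : E) : E →L[ℝ] E →L[ℝ] E →L[ℝ] E :=
  let dΓ := fderiv ℝ (christoffel g) y
  let ΓΓ := (ContinuousLinearMap.compL ℝ E E E).bilinearComp (christoffel g y) (christoffel g y)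
  dΓ - dΓ.flip + (ΓΓ - ΓΓ.flip)

/-- The gradient `∇_g u` of a function. -/
def gradient (g : E → E →L[ℝ] E →L[ℝ] ℝ) (u : E → ℝ) (y : E) : E :=
  (g y).inverse (fderiv ℝ u y)

/-- The Hessian `∇_g d u` of a function. -/
def hessian (g : E → E →L[ℝ] E →L[ℝ] ℝ) (u : E → ℝ) : E → E →L[ℝ] E →L[ℝ] ℝ :=
  cov (actHom (actR E)) g (cov (actR E) g u)

/-! The traces are written in a basis `b` of `E`, of which they do not depend. -/

variable [FiniteDimensional ℝ E] {n : ℕ} (b : Module.Basis (Fin n) ℝ E)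

/-- The linear forms of the dual basis. -/
def dualForm (i : Fin n) : E →L[ℝ] ℝ := LinearMap.toContinuousLinearMap (b.coord i)

/-- The Ricci tensor `Ric (g) (ξ, η) = Tr (ζ ↦ R_g (ζ, ξ) η)`. -/
def ricci (g : E → E →L[ℝ] E →L[ℝ] ℝ) (y : E) : E →L[ℝ] E →L[ℝ] ℝ :=
  ∑ i : Fin n, (ContinuousLinearMap.compL ℝ E E ℝ (dualForm b i)) ∘L (curvature g y (b i))

/-- The trace `Tr_g B = ∑ i, B (b_i, g⁻¹ b_i^*)` of an `F`-valued bilinear map. -/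
def trg (g : E →L[ℝ] E →L[ℝ] ℝ) (B : E →L[ℝ] E →L[ℝ] F) : F :=
  ∑ i : Fin n, B (b i) (g.inverse (dualForm b i))

/-- The function `log (dV_g / Ω)`, where `w = Ω (b₁, …, b_n)` and where `dV_g` is the volume form
of `g` for the orientation given by `Ω`. -/
def logDensity (g : E → E →L[ℝ] E →L[ℝ] ℝ) (w : E → ℝ) (y : E) : ℝ :=
  Real.log (Real.sqrt (Matrix.of fun i j : Fin n => g y (b i) (b j)).det / |w y|)

/-- The `Ω`-Bakry-Emery-Ricci tensor `Ric_g (Ω) = Ric (g) + ∇_g d log (dV_g / Ω)`. -/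
def bakryEmery (w : E → ℝ) (g : E → E →L[ℝ] E →L[ℝ] ℝ) (y : E) : E →L[ℝ] E →L[ℝ] ℝ :=
  ricci b g y + hessian g (logDensity b g w) y

/-- The `Ω`-Laplacian `Δ^Ω_g A = - Tr_g ∇_g² A + ∇_{g, ∇_g f} A` with `f = log (dV_g / Ω)`. -/
def omegaLaplacian (w : E → ℝ) (ρ : TensorAction E F) (g : E → E →L[ℝ] E →L[ℝ] ℝ) (A : E → F)
    (y : E) : F :=
  - trg b (g y) (cov (actHom ρ) g (cov ρ g A) y) + cov ρ g A y (gradient g (logDensity b g w) y)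

/-- The field of endomorphisms `Tr_g [∇_{g,•} A ∇_{g,•} A]`. -/
def traceSq (g : E → E →L[ℝ] E →L[ℝ] ℝ) (A : E → E →L[ℝ] E) (y : E) : E →L[ℝ] E :=
  trg b (g y) ((ContinuousLinearMap.compL ℝ E E E).bilinearComp
    (cov (actEnd E) g A y) (cov (actEnd E) g A y))

end Coordinates

/-! ### Tensor fields on a manifold and their coordinate expressions -/

section Manifold

/-- The model space `ℝⁿ`. -/
abbrev Rn (n : ℕ) : Type := EuclideanSpace ℝ (Fin n)

/-- The standard basis of `ℝⁿ`. -/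
def stdBasis (n : ℕ) : Module.Basis (Fin n) ℝ (Rn n) :=
  (EuclideanSpace.basisFun (Fin n) ℝ).toBasis

/-- Bilinear forms on `ℝⁿ`. -/
abbrev Bil (n : ℕ) : Type := Rn n →L[ℝ] Rn n →L[ℝ] ℝ

/-- Endomorphisms of `ℝⁿ`. -/
abbrev Endo (n : ℕ) : Type := Rn n →L[ℝ] Rn n

variable {n : ℕ} {X : Type*} [TopologicalSpace X] [ChartedSpace (Rn n) X]

/-- Fields of bilinear forms on the tangent spaces of `X`. -/
abbrev BilField (n : ℕ) (X : Type*) [TopologicalSpace X] [ChartedSpace (Rn n) X] : Type _ :=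
  ∀ x : X, TangentSpace (𝓡 n) x →L[ℝ] TangentSpace (𝓡 n) x →L[ℝ] ℝ

/-- Fields of endomorphisms of the tangent spaces of `X`. -/
abbrev EndField (n : ℕ) (X : Type*) [TopologicalSpace X] [ChartedSpace (Rn n) X] : Type _ :=
  ∀ x : X, TangentSpace (𝓡 n) x →L[ℝ] TangentSpace (𝓡 n) x

/-- The differential at `y` of the inverse of a chart. -/
def dchart (e : OpenPartialHomeomorph X (Rn n)) (y : Rn n) :
    Rn n →L[ℝ] TangentSpace (𝓡 n) (e.symm y) :=
  mfderiv 𝓘(ℝ, Rn n) (𝓡 n) e.symm y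

/-- The coordinate expression in a chart of a field of bilinear forms. -/
def bilChart (e : OpenPartialHomeomorph X (Rn n)) (v : BilField n X) (y : Rn n) : Bil n :=
  (ContinuousLinearMap.precomp ℝ (dchart e y)) ∘L (v (e.symm y)) ∘L (dchart e y)

/-- The coordinate expression in a chart of a field of endomorphisms. -/
def endChart (e : OpenPartialHomeomorph X (Rn n)) (A : EndField n X) (y : Rn n) : Endo n :=
  (dchart e y).inverse ∘L (A (e.symm y)) ∘L (dchart e y)

variable [IsManifold (𝓡 n) ∞ X]

variable (n X) in
/-- The smooth charts of `X`. -/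
abbrev charts : Set (OpenPartialHomeomorph X (Rn n)) := IsManifold.maximalAtlas (𝓡 n) ∞ X

variable (n X) in
/-- The set of smooth Riemannian metrics over `X`. -/
abbrev RiemMetric : Type _ :=
  ContMDiffRiemannianMetric (𝓡 n) ∞ (Rn n) (TangentSpace (𝓡 n) : X → Type _)

variable (n X) in
/-- Smooth sections of `T*_X ⊗ T*_X`. -/
abbrev BilSection : Type _ :=
  Cₛ^∞⟮𝓡 n; Bil n, fun x : X => TangentSpace (𝓡 n) x →L[ℝ] TangentSpace (𝓡 n) x →L[ℝ] ℝ⟯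

variable (n X) in
/-- Smooth sections of `End T_X`. -/
abbrev EndSection : Type _ :=
  Cₛ^∞⟮𝓡 n; Endo n, fun x : X => TangentSpace (𝓡 n) x →L[ℝ] TangentSpace (𝓡 n) x⟯

/-- A metric considered as a section of `T*_X ⊗ T*_X`. -/
def RiemMetric.toSection (g : RiemMetric n X) : BilSection n X := ⟨g.inner, g.contMDiff⟩

variable (n X) in
/-- A smooth volume form: a nowhere vanishing smooth `n`-form. It orients `X`, and it is positive
for this orientation. -/
structure VolumeForm where
  /-- the value at a point -/
  form : ∀ x : X, (TangentSpace (𝓡 n) x) [⋀^Fin n]→ₗ[ℝ] ℝ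
  ne_zero : ∀ x, form x ≠ 0
  smooth : ∀ e ∈ charts n X,
    ContDiffOn ℝ ∞ (fun y => form (e.symm y) fun i => dchart e y (stdBasis n i)) e.target

/-- The coordinate expression `w` of a volume form, `Ω = w dx₁ ∧ … ∧ dx_n`. -/
def VolumeForm.chart (Ω : VolumeForm n X) (e : OpenPartialHomeomorph X (Rn n)) (y : Rn n) : ℝ :=
  Ω.form (e.symm y) fun i => dchart e y (stdBasis n i)

/-- The coordinate expression of `Ric_g (Ω)`. -/
def ricChart (Ω : VolumeForm n X) (e : OpenPartialHomeomorph X (Rn n)) (g : RiemMetric n X) :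
    Rn n → Bil n :=
  bakryEmery (stdBasis n) (Ω.chart e) (bilChart e g.inner)

/-- The coordinate expression of `Ric*_g (Ω) = g⁻¹ Ric_g (Ω)`. -/
def ricStarChart (Ω : VolumeForm n X) (e : OpenPartialHomeomorph X (Rn n)) (g : RiemMetric n X)
    (y : Rn n) : Endo n :=
  sharp (bilChart e g.inner y) (ricChart Ω e g y)

/-- `K` has `n` distinct real eigenvalues almost everywhere over the `n`-dimensional manifold `X`:
in every chart, the exceptional set has Lebesgue measure zero. -/
def HasDistinctEigenvalues (K : EndSection n X) : Prop :=
  ∀ e ∈ charts n X, MeasureTheory.volume {y : Rn n | y ∈ e.target ∧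
    ¬ {c : ℝ | Module.End.HasEigenvalue
        (K (e.symm y) : TangentSpace (𝓡 n) (e.symm y) →ₗ[ℝ] TangentSpace (𝓡 n) (e.symm y))
        c}.ncard = n} = 0

/-- The space `𝔽_g` of the smooth symmetric 2-tensors `v` such that `∇_{T_X,g} (g⁻¹ v) = 0`. -/
def FF (g : RiemMetric n X) : Set (BilSection n X) :=
  {v | (∀ x ξ η, v x ξ η = v x η ξ) ∧
    ∀ e ∈ charts n X, ∀ y ∈ e.target, ∀ ξ η,
      extCov (bilChart e g.inner) (endChart e fun x => sharp (g.inner x) (v x)) y ξ η = 0}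

/-- The space `𝔽^K_g` of the `v ∈ 𝔽_g` such that `[∇_g^p T, g⁻¹ v] = 0` for `T = K`, `T = R_g`
and all `p ≥ 0`. -/
def FK (K : EndSection n X) (g : RiemMetric n X) : Set (BilSection n X) :=
  {v | v ∈ FF g ∧ ∀ e ∈ charts n X, ∀ y ∈ e.target, ∀ (p : ℕ) (ξ : Fin p → Rn n),
    Commute (iterCov (bilChart e g.inner) p (actEnd (Rn n)) (endChart e K) y ξ)
      (endChart e (fun x => sharp (g.inner x) (v x)) y) ∧
    ∀ ζ η : Rn n,
      Commute (iterCov (bilChart e g.inner) p (actHom (actHom (actEnd (Rn n))))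
          (curvature (bilChart e g.inner)) y ξ ζ η)
        (endChart e (fun x => sharp (g.inner x) (v x)) y)}

/-- The set of metrics `Σ_K (g₀) = 𝔽^K_{g₀} ∩ 𝓜`. -/
def SigmaK (K : EndSection n X) (g₀ : RiemMetric n X) : Set (RiemMetric n X) :=
  {g | g.toSection ∈ FK K g₀}

/-- The set `g₀⁻¹ Σ_K (g₀)` of fields of endomorphisms. -/
def SigmaKEnd (K : EndSection n X) (g₀ : RiemMetric n X) : Set (EndField n X) :=
  (fun (h : RiemMetric n X) x => sharp (g₀.inner x) (h.inner x)) '' SigmaK K g₀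

/-- The set `𝓢_Ω` of pre-scattering data: the metrics with `∇_{T_X,g} Ric*_g (Ω) = 0`. -/
def preScattering (Ω : VolumeForm n X) : Set (RiemMetric n X) :=
  {g | ∀ e ∈ charts n X, ∀ y ∈ e.target, ∀ ξ η,
    extCov (bilChart e g.inner) (ricStarChart Ω e g) y ξ η = 0}

/-- The field of endomorphisms `log (g₀⁻¹ g)`. -/
def logEnd (g₀ g : RiemMetric n X) : EndField n X :=
  fun x => funCalc Real.log (sharp (g₀.inner x) (g.inner x))

/-- The field of endomorphisms `H_g = (g⁻¹ g₀)^{1/2}`. -/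
def rootEnd (g₀ g : RiemMetric n X) : EndField n X :=
  fun x => funCalc Real.sqrt (sharp (g.inner x) (g₀.inner x))

/-- The time interval `[0, T)`, where `0 < T ≤ ∞`. -/
def timeInterval (T : EReal) : Set ℝ := {t : ℝ | 0 ≤ t ∧ (t : EReal) < T}

/-- `(g_t)`, `t ∈ J`, is a `Ω`-Soliton-Ricci flow: a smooth family of metrics in `𝓢_Ω` with
`dg_t/dt = Ric_{g_t} (Ω) - g_t`. -/
structure IsSolitonRicciFlow (Ω : VolumeForm n X) (J : Set ℝ) (g : ℝ → RiemMetric n X) : Prop where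
  smooth : ∀ e ∈ charts n X,
    ContDiffOn ℝ ∞ (fun q : ℝ × Rn n => bilChart e (g q.1).inner q.2) (J ×ˢ e.target)
  mem : ∀ t ∈ J, g t ∈ preScattering Ω
  evolution : ∀ e ∈ charts n X, ∀ y ∈ e.target, ∀ t ∈ J,
    HasDerivWithinAt (fun s => bilChart e (g s).inner y)
      (ricChart Ω e (g t) y - bilChart e (g t).inner y) J t

/-- `(H_t)`, `t ∈ J`, is a smooth solution of
`2 dH_t/dt = - H_t² Δ^Ω_{g₀} H_t - H_t³ Ric*_{g₀} (Ω) + H_t`. -/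
structure IsPorousMediumFlow (Ω : VolumeForm n X) (g₀ : RiemMetric n X) (J : Set ℝ)
    (H : ℝ → EndField n X) : Prop where
  smooth : ∀ e ∈ charts n X,
    ContDiffOn ℝ ∞ (fun q : ℝ × Rn n => endChart e (H q.1) q.2) (J ×ˢ e.target)
  evolution : ∀ e ∈ charts n X, ∀ y ∈ e.target, ∀ t ∈ J,
    ∃ D : Endo n, HasDerivWithinAt (fun s => endChart e (H s) y) D J t ∧
      (2 : ℝ) • D =
        - (endChart e (H t) y ^ 2 *
            omegaLaplacian (stdBasis n) (Ω.chart e) (actEnd (Rn n)) (bilChart e g₀.inner) (endChart e (H t)) y)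
        - endChart e (H t) y ^ 3 * ricStarChart Ω e g₀ y
        + endChart e (H t) y

end Manifold

end SolitonRicci

end

set_option linter.unusedSectionVars false

/-! Put `B = g₀⁻¹ g` and `L = log B`, so that `g = g₀ exp L` and `H = exp (-L/2)`. The bracket
conditions make all the endomorphisms in play commute, and the geometry of `g` is then computed as
if `L` were a scalar.

Commutation. Where `K` has simple spectrum its commutant is commutative, and such points are dense,
so by continuity any two continuous fields commuting with `K` commute everywhere
(`IsGenericallySimple.commute`). `L` commutes with `K`; differentiating `[K, L] = 0` and using `[∇K,
B] = 0` shows that `∇L` does too. So `L` and all `∇_ξ L` commute with one another, `∇ exp (r L) = r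
exp (r L) ∇L`, and the Codazzi equation passes from `B` to `L` (`IsSigmaOn.isCommutingLog`).

Curvature. By uniqueness of the Levi-Civita connection, `Γ_g = Γ_{g₀} + ½ ∇L`. The curvature does
not change: the linear term is `[R, L] = 0` by the Ricci identity, and the quadratic one is a
commutator of derivatives of `L`. Only the density changes, `f_g = f_{g₀} + ½ Tr L`. Its Hessian
gives formula (1), since `∇²L` is totally symmetric (`IsCommutingLog.bakryEmery_eq`). As `Δ^Ω H = H
(-½ Δ^Ω L - ¼ Tr (∇L ∇L))`, the correction in (1) is `H⁻¹ Δ^Ω H` up to `g₀`, which is formula (2).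

Flow. `Σ_K (g₀)` is stable under `B ↦ B^r`, hence the bijection. The `L_t` at different times
commute, so the equations for `g_t` and for `H_t` both say `L̇_t = Ric*_{g_t} (Ω) - 1`. The
condition `∇_{T_X,g_t} Ric* = 0` is then a consequence: `L̇_t` is Codazzi for `g₀` as a derivative
of Codazzi fields, and for `g_t` because `∇L_t` commutes with `L̇_t` (`extCov_deriv_eq_zero`). -/

noncomputable section

namespace SolitonRicci

/-! ### Scalar products, real diagonalization and functional calculus. -/

section LinearAlgebra

variable {V : Type*} [AddCommGroup V] [Module ℝ V] [TopologicalSpace V]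
  [IsTopologicalAddGroup V] [ContinuousSMul ℝ V]

/-- A symmetric positive definite bilinear form. -/
structure IsScalarProduct (g : V →L[ℝ] V →L[ℝ] ℝ) : Prop where
  symm : ∀ x y, g x y = g y x
  pos : ∀ x, x ≠ 0 → 0 < g x x

/-- A basis which diagonalizes an endomorphism. -/
def IsEigenbasis {ι : Type*} (b : Module.Basis ι ℝ V) (c : ι → ℝ) (B : V →L[ℝ] V) : Prop :=
  ∀ i, B (b i) = c i • b i

/-- The spectral theorem for the inner product given by `g`. Here `V` carries no topology, so the
norm built from `g` meets no other one. -/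
theorem exists_eigenbasis_of_isSymmetric {V : Type*} [AddCommGroup V] [Module ℝ V]
    [FiniteDimensional ℝ V] (g : V →ₗ[ℝ] V →ₗ[ℝ] ℝ) (hs : ∀ x y, g x y = g y x)
    (hp : ∀ x, x ≠ 0 → 0 < g x x) (B : V →ₗ[ℝ] V) (hB : ∀ x y, g (B x) y = g x (B y)) :
    ∃ (b : Module.Basis (Fin (Module.finrank ℝ V)) ℝ V) (c : Fin (Module.finrank ℝ V) → ℝ),
      ∀ i, B (b i) = c i • b i := by
  let core : InnerProductSpace.Core ℝ V :=
    { inner := fun x y => g x y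
      conj_inner_symm := fun x y => by simp [hs y x]
      re_inner_nonneg := fun x => by
        by_cases h : x = 0
        · simp [h]
        · exact (hp x h).le
      add_left := fun x y z => by simp
      smul_left := fun x y r => by simp
      definite := fun x hx => by
        by_contra h
        exact (hp x h).ne' hx }
  let _ : NormedAddCommGroup V := core.toNormedAddCommGroup
  let _ : InnerProductSpace ℝ V := InnerProductSpace.ofCore core.toCore
  have hsym : B.IsSymmetric := fun x y => hB x y
  refine ⟨(hsym.eigenvectorBasis rfl).toBasis, hsym.eigenvalues rfl, fun i => ?_⟩
  simp

theorem IsScalarProduct.exists_eigenbasis [FiniteDimensional ℝ V] {g : V →L[ℝ] V →L[ℝ] ℝ}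
    (hg : IsScalarProduct g) {B : V →L[ℝ] V} (hB : ∀ x y, g (B x) y = g x (B y)) :
    ∃ (b : Module.Basis (Fin (Module.finrank ℝ V)) ℝ V) (c : Fin (Module.finrank ℝ V) → ℝ),
      IsEigenbasis b c B :=
  exists_eigenbasis_of_isSymmetric
    ((ContinuousLinearMap.coeLM ℝ).comp (g : V →ₗ[ℝ] V →L[ℝ] ℝ)) hg.symm hg.pos B hB

/-- Reduces identities of the functional calculus to identities between real functions of the
eigenvalues. -/
theorem IsEigenbasis.ext {ι : Type*} {b : Module.Basis ι ℝ V} {c : ι → ℝ} {B C : V →L[ℝ] V}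
    (hB : IsEigenbasis b c B) (hC : IsEigenbasis b c C) : B = C :=
  ContinuousLinearMap.coe_injective (b.ext fun i => (hB i).trans (hC i).symm)

/-- A polynomial in `B` acts on an eigenvector through its value at the eigenvalue, and each `c i`
is a root of the minimal polynomial, hence an interpolation node. -/
theorem IsEigenbasis.funCalc [FiniteDimensional ℝ V] {ι : Type*} {b : Module.Basis ι ℝ V}
    {c : ι → ℝ} {B : V →L[ℝ] V} (hB : IsEigenbasis b c B) (φ : ℝ → ℝ) :
    IsEigenbasis b (fun i => φ (c i)) (funCalc φ B) := by
  intro i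
  have haev : ∀ p : Polynomial ℝ, (Polynomial.aeval B p) (b i) = p.eval (c i) • b i := by
    intro p
    induction p using Polynomial.induction_on' with
    | add p q hp hq => simp [hp, hq, add_smul]
    | monomial k a =>
      have hk : (B ^ k) (b i) = (c i) ^ k • b i := by
        induction k with
        | zero => simp
        | succ k ih =>
          rw [pow_succ', mul_apply_eq_comp, ih, map_smul, hB i, smul_smul, pow_succ]
      simp [Polynomial.aeval_monomial, hk, mul_smul, Algebra.algebraMap_eq_smul_one]
  rw [SolitonRicci.funCalc, haev]
  have hroot : c i ∈ (minpoly ℝ (B : V →ₗ[ℝ] V)).roots.toFinset := by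
    rw [Multiset.mem_toFinset, Polynomial.mem_roots (minpoly.ne_zero (Algebra.IsIntegral.isIntegral _))]
    exact Module.End.isRoot_of_hasEigenvalue
      (Module.End.hasEigenvalue_of_hasEigenvector
        ⟨Module.End.mem_eigenspace_iff.2 (hB i), b.ne_zero i⟩)
  exact congrArg (· • b i) (Lagrange.eval_interpolate_at_node (i := c i) (v := id) φ
    Function.injective_id.injOn hroot)

/-- `funCalc φ B` is a polynomial in `B`. This carries the bracket conditions from `g₀⁻¹ g` to its
logarithm and to its powers. -/
theorem commute_funCalc {M B : V →L[ℝ] V} (h : Commute M B) (φ : ℝ → ℝ) :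
    Commute M (funCalc φ B) := by
  suffices key : ∀ p : Polynomial ℝ, Commute M (Polynomial.aeval B p) from key _
  intro p
  induction p using Polynomial.induction_on' with
  | add p q hp hq => rw [map_add]; exact hp.add_right hq
  | monomial k a =>
    rw [Polynomial.aeval_monomial]
    exact (Algebra.commute_algebraMap_right a M).mul_right (h.pow_right k)

variable [FiniteDimensional ℝ V] [T2Space V]

/-- An endomorphism which is diagonalizable with positive eigenvalues. -/
def IsPositive (B : V →L[ℝ] V) : Prop :=
  ∃ (b : Module.Basis (Fin (Module.finrank ℝ V)) ℝ V) (c : Fin (Module.finrank ℝ V) → ℝ),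
    (∀ i, 0 < c i) ∧ IsEigenbasis b c B

theorem IsScalarProduct.isPositive {g : V →L[ℝ] V →L[ℝ] ℝ} (hg : IsScalarProduct g)
    {B : V →L[ℝ] V} (hB : IsScalarProduct (g ∘L B)) : IsPositive B := by
  obtain ⟨b, c, h⟩ := hg.exists_eigenbasis (B := B)
    (fun x y => (hB.symm x y).trans (hg.symm (B y) x))
  refine ⟨b, c, fun i => ?_, h⟩
  have h1 := hB.pos (b i) (b.ne_zero i)
  have h2 := hg.pos (b i) (b.ne_zero i)
  have h3 : g (B (b i)) (b i) = c i * g (b i) (b i) := by simp [h i]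
  rw [ContinuousLinearMap.comp_apply, h3] at h1
  exact pos_of_mul_pos_left h1 h2.le

theorem IsScalarProduct.isInvertible {g : V →L[ℝ] V →L[ℝ] ℝ} (hg : IsScalarProduct g) :
    g.IsInvertible := by
  let g' : V →ₗ[ℝ] Module.Dual ℝ V := (ContinuousLinearMap.coeLM ℝ).comp (g : V →ₗ[ℝ] V →L[ℝ] ℝ)
  have hinj : Function.Injective g' := by
    rw [injective_iff_map_eq_zero]
    intro x hx
    by_contra h
    have := hg.pos x h
    have h2 : g x x = 0 := congrArg (fun T : Module.Dual ℝ V => T x) hx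
    linarith
  let e0 : V ≃ₗ[ℝ] Module.Dual ℝ V := LinearEquiv.ofInjectiveOfFinrankEq g' hinj (Subspace.dual_finrank_eq).symm
  let e : V ≃ₗ[ℝ] (V →L[ℝ] ℝ) := e0.trans LinearMap.toContinuousLinearMap
  refine ⟨e.toContinuousLinearEquiv, ?_⟩
  ext x y
  rfl

theorem IsScalarProduct.inverse_apply_left {g : V →L[ℝ] V →L[ℝ] ℝ} (hg : IsScalarProduct g)
    (l : V →L[ℝ] ℝ) : g (g.inverse l) = l := by
  obtain ⟨e, rfl⟩ := hg.isInvertible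
  simp

theorem IsScalarProduct.inverse_apply_right {g : V →L[ℝ] V →L[ℝ] ℝ} (hg : IsScalarProduct g)
    (x : V) : g.inverse (g x) = x := by
  obtain ⟨e, rfl⟩ := hg.isInvertible
  simp

theorem IsScalarProduct.apply_sharp {g : V →L[ℝ] V →L[ℝ] ℝ} (hg : IsScalarProduct g)
    (v : V →L[ℝ] V →L[ℝ] ℝ) (x : V) : g (sharp g v x) = v x :=
  hg.inverse_apply_left _

theorem IsScalarProduct.sharp_comp {g : V →L[ℝ] V →L[ℝ] ℝ} (hg : IsScalarProduct g)
    (A : V →L[ℝ] V) : sharp g (g ∘L A) = A := by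
  ext x
  exact hg.inverse_apply_right _

theorem IsScalarProduct.comp_sharp {g : V →L[ℝ] V →L[ℝ] ℝ} (hg : IsScalarProduct g)
    (v : V →L[ℝ] V →L[ℝ] ℝ) : g ∘L sharp g v = v := by
  ext x : 1
  exact hg.apply_sharp v x

end LinearAlgebra

/-! ### Exponential and smooth logarithm of endomorphisms. -/

section Exponential

variable {E : Type*} [NormedAddCommGroup E] [NormedSpace ℝ E] [FiniteDimensional ℝ E]

/-- The exponential of an endomorphism. -/
def expEnd (B : E →L[ℝ] E) : E →L[ℝ] E := NormedSpace.exp B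

theorem contDiff_expEnd : ContDiff ℝ ∞ (expEnd : (E →L[ℝ] E) → (E →L[ℝ] E)) := by
  have : AnalyticOnNhd ℝ (expEnd : (E →L[ℝ] E) → (E →L[ℝ] E)) univ :=
    fun x _ => NormedSpace.exp_analytic (𝕂 := ℝ) x
  exact this.contDiff.of_le le_top

theorem expEnd_add {B C : E →L[ℝ] E} (h : Commute B C) :
    expEnd (B + C) = expEnd B * expEnd C := by
  let _ : NormedAlgebra ℚ (E →L[ℝ] E) := NormedAlgebra.restrictScalars ℚ ℝ _
  exact NormedSpace.exp_add_of_commute h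

theorem expEnd_zero : expEnd (0 : E →L[ℝ] E) = 1 := NormedSpace.exp_zero

theorem commute_expEnd {M B : E →L[ℝ] E} (h : Commute M B) : Commute M (expEnd B) :=
  Commute.exp_right h

theorem IsEigenbasis.expEnd {ι : Type*} {b : Module.Basis ι ℝ E} {c : ι → ℝ} {B : E →L[ℝ] E}
    (h : IsEigenbasis b c B) : IsEigenbasis b (fun i => Real.exp (c i)) (expEnd B) := by
  intro i
  have hk : ∀ k : ℕ, (B ^ k) (b i) = (c i) ^ k • b i := by
    intro k
    induction k with
    | zero => simp
    | succ k ih =>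
      rw [pow_succ', mul_apply_eq_comp, ih, map_smul, h i, smul_smul, pow_succ]
  have h1 := (ContinuousLinearMap.apply ℝ E (b i)).hasSum
    (NormedSpace.exp_series_hasSum_exp' (𝕂 := ℝ) B)
  have h2 := (NormedSpace.exp_series_hasSum_exp' (𝕂 := ℝ) (c i)).smul_const (b i)
  rw [← Real.exp_eq_exp_ℝ] at h2
  refine h1.unique ?_
  convert h2 using 2 with k
  simp [hk, smul_smul]

/-- Along the line `A y + t • A' ξ` the exponential splits as `exp (A y) exp (t A' ξ)`, because the
two terms commute. -/
theorem fderiv_expEnd_comp {W : Type*} [NormedAddCommGroup W] [NormedSpace ℝ W]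
    {A : W → E →L[ℝ] E} {A' : W →L[ℝ] E →L[ℝ] E} {y : W} (h : HasFDerivAt A A' y) (ξ : W)
    (hc : Commute (A y) (A' ξ)) :
    fderiv ℝ (fun z => expEnd (A z)) y ξ = expEnd (A y) * A' ξ := by
  have hd : HasFDerivAt (expEnd : (E →L[ℝ] E) → _) (fderiv ℝ expEnd (A y)) (A y) :=
    (contDiff_expEnd.differentiable (by simp) (A y)).hasFDerivAt
  rw [show (fun z => expEnd (A z)) = expEnd ∘ A from rfl, (hd.comp y h).fderiv,
    ContinuousLinearMap.comp_apply]
  have h1 : HasDerivAt (fun t : ℝ => expEnd (A y + t • A' ξ))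
      (fderiv ℝ expEnd (A y) (A' ξ)) 0 := by
    have hl : HasDerivAt (fun t : ℝ => A y + t • A' ξ) (A' ξ) 0 := by
      simpa using ((hasDerivAt_id (0 : ℝ)).smul_const (A' ξ)).const_add (A y)
    have hd' : HasFDerivAt (expEnd : (E →L[ℝ] E) → _) (fderiv ℝ expEnd (A y))
      (A y + (0 : ℝ) • A' ξ) := by simpa using hd
    exact hd'.comp_hasDerivAt 0 hl
  have h2 : HasDerivAt (fun t : ℝ => expEnd (A y + t • A' ξ))
      (expEnd (A y) * A' ξ) 0 := by
    have h3 := (hasDerivAt_exp_smul_const (𝕂 := ℝ) (A' ξ) 0).const_mul (expEnd (A y))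
    simp only [zero_smul, NormedSpace.exp_zero, one_mul] at h3
    exact h3.congr_of_eventuallyEq (Filter.Eventually.of_forall fun t =>
      expEnd_add (hc.smul_right t))
  exact h1.unique h2

open MeasureTheory in
/-- Integration over `[0, 1]` of the continuous functions. -/
def integralUnit (F : Type*) [NormedAddCommGroup F] [NormedSpace ℝ F] [CompleteSpace F] :
    C(unitInterval, F) →L[ℝ] F :=
  LinearMap.mkContinuous
    { toFun := fun f => ∫ s, f s
      map_add' := fun f g => integral_add (f.continuous.integrable_of_hasCompactSupport
        (HasCompactSupport.of_compactSpace _)) (g.continuous.integrable_of_hasCompactSupport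
        (HasCompactSupport.of_compactSpace _))
      map_smul' := fun r f => integral_smul r _ } 1 (fun f => by
        have := norm_integral_le_of_norm_le_const (μ := (volume : Measure unitInterval)) (f := f)
          (C := ‖f‖) (Filter.Eventually.of_forall fun s => f.norm_coe_le_norm s)
        simpa using this)

/-- The path `s ↦ 1 + s (B - 1)`. -/
def segmentPath (B : E →L[ℝ] E) : C(unitInterval, E →L[ℝ] E) :=
  1 + (⟨fun s => (s : ℝ) • 1, by fun_prop⟩ : C(unitInterval, E →L[ℝ] E)) *
    ContinuousLinearMap.const ℝ unitInterval (B - 1)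

/-- The logarithm `∫₀¹ (B - 1) (1 + s (B - 1))⁻¹ ds`. -/
def logInt (B : E →L[ℝ] E) : E →L[ℝ] E :=
  (B - 1) * integralUnit (E →L[ℝ] E) (Ring.inverse (segmentPath B))

theorem segmentPath_apply (B : E →L[ℝ] E) (s : unitInterval) :
    segmentPath B s = 1 + (s : ℝ) • (B - 1) := by
  rfl

theorem contDiff_segmentPath :
    ContDiff ℝ ∞ (segmentPath : (E →L[ℝ] E) → C(unitInterval, E →L[ℝ] E)) := by
  unfold segmentPath
  exact contDiff_const.add (contDiff_const.mul ((ContinuousLinearMap.contDiff _).comp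
    (contDiff_id.sub contDiff_const)))

theorem IsEigenbasis.isUnit {ι : Type*} [Finite ι] {b : Module.Basis ι ℝ E} {c : ι → ℝ} {B : E →L[ℝ] E}
    (h : IsEigenbasis b c B) (hc : ∀ i, c i ≠ 0) : IsUnit B := by
  let C : E →L[ℝ] E := LinearMap.toContinuousLinearMap (b.constr ℝ fun i => (c i)⁻¹ • b i)
  have hC : IsEigenbasis b (fun i => (c i)⁻¹) C := fun i => by simp [C, b.constr_basis]
  have h1 : ∀ A : E →L[ℝ] E, IsEigenbasis b (fun _ => 1) A → A = 1 :=
    fun A hA => hA.ext fun i => by simp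
  refine ⟨⟨B, C, h1 _ fun i => ?_, h1 _ fun i => ?_⟩, rfl⟩
  · simp [hC i, h i, smul_smul, hc i]
  · simp [hC i, h i, smul_smul, hc i]

theorem IsEigenbasis.inverse {ι : Type*} [Finite ι] {b : Module.Basis ι ℝ E} {c : ι → ℝ} {B : E →L[ℝ] E}
    (h : IsEigenbasis b c B) (hc : ∀ i, c i ≠ 0) :
    IsEigenbasis b (fun i => (c i)⁻¹) (Ring.inverse B) := by
  intro i
  have h1 : Ring.inverse B * B = 1 := Ring.inverse_mul_cancel _ (h.isUnit hc)
  have h2 := congrArg (fun T : E →L[ℝ] E => T (b i)) h1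
  simp only [mul_apply_eq_comp, h i, map_smul, one_apply_eq_self] at h2
  rw [← h2, smul_smul, inv_mul_cancel₀ (hc i), one_smul, h2]

theorem IsEigenbasis.segmentPath {ι : Type*} {b : Module.Basis ι ℝ E} {c : ι → ℝ} {B : E →L[ℝ] E}
    (h : IsEigenbasis b c B) (s : unitInterval) :
    IsEigenbasis b (fun i => 1 + (s : ℝ) * (c i - 1)) (segmentPath B s) := by
  intro i
  simp [segmentPath_apply, h i, add_smul, sub_smul, smul_sub, mul_smul, mul_sub]

theorem one_add_mul_sub_one_pos {c s : ℝ} (hc : 0 < c) (hs : s ∈ Icc (0 : ℝ) 1) :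
    0 < 1 + s * (c - 1) := by
  rcases hs.2.eq_or_lt with h | h
  · simpa [h] using hc
  · nlinarith [mul_nonneg hs.1 hc.le]

theorem isUnit_segmentPath {B : E →L[ℝ] E} (hB : IsPositive B) : IsUnit (segmentPath B) := by
  obtain ⟨b, c, hc, h⟩ := hB
  rw [ContinuousMap.isUnit_iff_forall_isUnit]
  exact fun s => (h.segmentPath s).isUnit fun i => (one_add_mul_sub_one_pos (hc i) s.2).ne'

/-- Inversion is smooth at the units of the Banach algebra of continuous paths of endomorphisms over
`[0, 1]`, and for positive `B` the segment from `1` to `B` is such a unit. -/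
theorem contDiffAt_logInt {B : E →L[ℝ] E} (hB : IsPositive B) : ContDiffAt ℝ ∞ logInt B := by
  obtain ⟨u, hu⟩ := isUnit_segmentPath hB
  have h0 : ContDiffAt ℝ ∞ Ring.inverse (segmentPath B) := hu ▸ contDiffAt_ringInverse ℝ u
  have h1 : ContDiffAt ℝ ∞ (fun B : E →L[ℝ] E => Ring.inverse (segmentPath B)) B :=
    h0.comp B contDiff_segmentPath.contDiffAt
  exact (contDiffAt_id.sub contDiffAt_const).mul
    ((ContinuousLinearMap.contDiff _).contDiffAt.comp B h1)

/-- The integrand times `c - 1` is the derivative of `s ↦ log (1 + s (c - 1))`. -/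
theorem integral_unit_log {c : ℝ} (hc : 0 < c) :
    (c - 1) * ∫ s : unitInterval, (1 + (s : ℝ) * (c - 1))⁻¹ = Real.log c := by
  have h1 : ∫ s : unitInterval, (1 + (s : ℝ) * (c - 1))⁻¹ =
      ∫ s in (0 : ℝ)..1, (1 + s * (c - 1))⁻¹ := by
    rw [intervalIntegral.integral_of_le zero_le_one, ← MeasureTheory.integral_Icc_eq_integral_Ioc]
    exact MeasureTheory.integral_subtype_comap measurableSet_Icc
      (fun s : ℝ => (1 + s * (c - 1))⁻¹)
  have hpos : ∀ s ∈ uIcc (0 : ℝ) 1, 0 < 1 + s * (c - 1) := fun s hs =>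
    one_add_mul_sub_one_pos hc (by rwa [uIcc_of_le zero_le_one] at hs)
  rw [h1, ← intervalIntegral.integral_const_mul]
  rw [intervalIntegral.integral_eq_sub_of_hasDerivAt
    (f := fun s => Real.log (1 + s * (c - 1)))]
  · simp
  · intro s hs
    have h2 : HasDerivAt (fun s : ℝ => 1 + s * (c - 1)) (c - 1) s := by
      simpa using ((hasDerivAt_id s).mul_const (c - 1)).const_add 1
    simpa [div_eq_mul_inv] using h2.log (hpos s hs).ne'
  · refine ContinuousOn.intervalIntegrable (continuousOn_const.mul (ContinuousOn.inv₀ ?_ ?_))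
    · fun_prop
    · exact fun s hs => (hpos s hs).ne'

/-- The interpolation polynomial defining `funCalc` changes with the spectrum of `B` and shows no
regularity; the integral formula makes the logarithm a smooth function of `B`. -/
theorem funCalc_log {B : E →L[ℝ] E} (hB : IsPositive B) : funCalc Real.log B = logInt B := by
  have hu := isUnit_segmentPath hB
  obtain ⟨b, c, hc, h⟩ := hB
  refine (h.funCalc Real.log).ext fun i => ?_
  have hne : ∀ (s : unitInterval) i, 1 + (s : ℝ) * (c i - 1) ≠ 0 :=
    fun s i => (one_add_mul_sub_one_pos (hc i) s.2).ne'
  have h1 : ∀ s, Ring.inverse (segmentPath B) s = Ring.inverse (segmentPath B s) := by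
    intro s
    have h2 : (Ring.inverse (segmentPath B)) s * segmentPath B s = 1 := by
      rw [← ContinuousMap.mul_apply, Ring.inverse_mul_cancel _ hu, ContinuousMap.one_apply]
    have h3 : segmentPath B s * Ring.inverse (segmentPath B s) = 1 :=
      Ring.mul_inverse_cancel _ ((h.segmentPath s).isUnit (hne s))
    exact left_inv_eq_right_inv h2 h3
  have h4 : (integralUnit (E →L[ℝ] E) (Ring.inverse (segmentPath B))) (b i) =
      (∫ s : unitInterval, (1 + (s : ℝ) * (c i - 1))⁻¹) • b i := by
    rw [← integral_smul_const]
    change (∫ s, Ring.inverse (segmentPath B) s) (b i) = _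
    rw [ContinuousLinearMap.integral_apply]
    · refine MeasureTheory.integral_congr_ae (Filter.Eventually.of_forall fun s => ?_)
      simp only [h1]
      exact ((h.segmentPath s).inverse (hne s)) i
    · exact (Ring.inverse (segmentPath B)).continuous.integrable_of_hasCompactSupport
        (HasCompactSupport.of_compactSpace _)
  rw [logInt, mul_apply_eq_comp, h4, map_smul, sub_apply, h i, one_apply_eq_self]
  simp only [← integral_unit_log (hc i)]
  rw [mul_comm, mul_smul, sub_smul, one_smul]

theorem IsPositive.expEnd_log {B : E →L[ℝ] E} (hB : IsPositive B) :
    expEnd (funCalc Real.log B) = B := by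
  obtain ⟨b, c, hc, h⟩ := hB
  refine (h.funCalc Real.log).expEnd.ext fun i => ?_
  simp only [h i, Real.exp_log (hc i)]

theorem isEigenbasis_smul {ι : Type*} {b : Module.Basis ι ℝ E} {c : ι → ℝ} {B : E →L[ℝ] E}
    (h : IsEigenbasis b c B) (r : ℝ) : IsEigenbasis b (fun i => r * c i) (r • B) := fun i => by
  simp [h i, smul_smul]

theorem det_expEnd {ι : Type*} [Fintype ι] [DecidableEq ι] {b : Module.Basis ι ℝ E} {c : ι → ℝ}
    {B : E →L[ℝ] E} (h : IsEigenbasis b c B) :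
    LinearMap.det (expEnd B : E →ₗ[ℝ] E) = Real.exp (LinearMap.trace ℝ E B) := by
  have h1 : ∀ (A : E →L[ℝ] E) (a : ι → ℝ), IsEigenbasis b a A →
      LinearMap.toMatrix b b (A : E →ₗ[ℝ] E) = Matrix.diagonal a := by
    intro A a hA
    ext i j
    rw [LinearMap.toMatrix_apply, ContinuousLinearMap.coe_coe, hA j]
    by_cases hij : i = j
    · subst hij; simp
    · simp [hij]
  rw [← LinearMap.det_toMatrix b, LinearMap.trace_eq_matrix_trace ℝ b, h1 _ _ h, h1 _ _ h.expEnd,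
    Matrix.det_diagonal, Matrix.trace_diagonal, Real.exp_sum]

end Exponential

/-! ### Endomorphisms with simple real spectrum. -/

section Commutant

variable {V : Type*} [AddCommGroup V] [Module ℝ V] [TopologicalSpace V]
  [IsTopologicalAddGroup V] [ContinuousSMul ℝ V] [FiniteDimensional ℝ V]

/-- The commutant of an endomorphism with simple spectrum is commutative. -/
theorem commute_of_distinct_eigenvalues {K M N : V →L[ℝ] V}
    (hK : {c : ℝ | Module.End.HasEigenvalue (K : V →ₗ[ℝ] V) c}.ncard = Module.finrank ℝ V)
    (hM : Commute K M) (hN : Commute K N) : Commute M N := by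
  set S := {c : ℝ | Module.End.HasEigenvalue (K : V →ₗ[ℝ] V) c}
  have hfin : S.Finite := Module.End.finite_hasEigenvalue (K : V →ₗ[ℝ] V)
  have : Fintype S := hfin.fintype
  choose x hx using fun c : S => Module.End.HasEigenvalue.exists_hasEigenvector c.2
  have hli : LinearIndependent ℝ x :=
    Module.End.eigenvectors_linearIndependent' (K : V →ₗ[ℝ] V) _ Subtype.val_injective x hx
  have hcard : Fintype.card S = Module.finrank ℝ V := by
    rw [← hK, ← Nat.card_coe_set_eq, Nat.card_eq_fintype_card]
  let b := basisOfLinearIndependentOfCardEqFinrank' x hli hcard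
  have hb : ∀ i, K (b i) = (i : ℝ) • b i := fun i => by
    simpa [b] using (hx i).apply_eq_smul
  -- What commutes with `K` is diagonal in the eigenbasis of `K`: its coefficient between the
  -- eigenvalues `i` and `j` is killed by `i - j`.
  have key : ∀ A : V →L[ℝ] V, Commute K A → ∃ a : S → ℝ, IsEigenbasis b a A := by
    intro A hA
    refine ⟨fun i => b.repr (A (b i)) i, fun i => b.repr.injective ?_⟩
    ext j
    have h1 : K (A (b i)) = (i : ℝ) • A (b i) := by
      rw [← map_smul, ← hb i]
      exact congrArg (fun T : V →L[ℝ] V => T (b i)) hA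
    have h2 : ∀ v, b.repr (K v) j = (j : ℝ) * b.repr v j := by
      have h : (b.coord j) ∘ₗ (K : V →ₗ[ℝ] V) = (j : ℝ) • b.coord j := b.ext fun k => by
        by_cases hkj : k = j
        · subst hkj; simp [hb k]
        · simp [hb k, hkj]
      exact fun v => congrArg (fun T : V →ₗ[ℝ] ℝ => T v) h
    have h3 := h2 (A (b i))
    rw [h1] at h3
    by_cases hij : i = j
    · subst hij; simp
    · have h4 : ((i : ℝ) - j) * b.repr (A (b i)) j = 0 := by
        have : (i : ℝ) * b.repr (A (b i)) j = j * b.repr (A (b i)) j := by simpa using h3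
        linarith
      have h5 : (i : ℝ) - j ≠ 0 := sub_ne_zero.2 fun h => hij (Subtype.ext h)
      simp [(mul_eq_zero.1 h4).resolve_left h5, hij]
  obtain ⟨a, ha⟩ := key M hM
  obtain ⟨a', ha'⟩ := key N hN
  refine IsEigenbasis.ext (b := b) (c := fun i => a i * a' i) (fun i => ?_) fun i => ?_
  · simp [ha i, ha' i, smul_smul, mul_comm]
  · simp [ha i, ha' i, smul_smul]

end Commutant

/-! ### The differential of the exponential in commuting and in commutator directions. -/

section Exponential

variable {E : Type*} [NormedAddCommGroup E] [NormedSpace ℝ E] [FiniteDimensional ℝ E]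

theorem fderiv_expEnd_of_commute {A X : E →L[ℝ] E} (hc : Commute A X) :
    fderiv ℝ expEnd A X = expEnd A * X := by
  have h := fderiv_expEnd_comp (A := fun z : E →L[ℝ] E => z) (hasFDerivAt_id A) X hc
  simpa using h

/-- The derivative at `t = 0` of `exp (e^{tX} A e^{-tX}) = e^{tX} (exp A) e^{-tX}`. It handles the
Christoffel terms of `∇ exp A`, which need not commute with `A`. -/
theorem fderiv_expEnd_commutator (A X : E →L[ℝ] E) :
    fderiv ℝ expEnd A (X * A - A * X) = X * expEnd A - expEnd A * X := by
  let _ : NormedAlgebra ℚ (E →L[ℝ] E) := NormedAlgebra.restrictScalars ℚ ℝ _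
  have hd : HasFDerivAt (expEnd : (E →L[ℝ] E) → _) (fderiv ℝ expEnd A) A :=
    (contDiff_expEnd.differentiable (by simp) A).hasFDerivAt
  have hX : HasDerivAt (fun t : ℝ => NormedSpace.exp (t • X)) X 0 := by
    simpa using hasDerivAt_exp_smul_const (𝕂 := ℝ) X 0
  have hX' : HasDerivAt (fun t : ℝ => NormedSpace.exp (-(t • X))) (-X) 0 := by
    simpa [smul_neg] using hasDerivAt_exp_smul_const (𝕂 := ℝ) (-X) 0
  have hconj : ∀ B : E →L[ℝ] E, HasDerivAt
      (fun t : ℝ => NormedSpace.exp (t • X) * B * NormedSpace.exp (-(t • X))) (X * B - B * X) 0 := by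
    intro B
    convert! (hX.mul_const B).mul hX' using 1
    simp [sub_eq_add_neg]
  have h1 : HasDerivAt (fun t : ℝ => expEnd (NormedSpace.exp (t • X) * A *
      NormedSpace.exp (-(t • X)))) (fderiv ℝ expEnd A (X * A - A * X)) 0 := by
    have hd' : HasFDerivAt (expEnd : (E →L[ℝ] E) → _) (fderiv ℝ expEnd A)
      (NormedSpace.exp ((0 : ℝ) • X) * A * NormedSpace.exp (-((0 : ℝ) • X))) := by simpa using hd
    exact hd'.comp_hasDerivAt 0 (hconj A)
  refine h1.unique ((hconj (expEnd A)).congr_of_eventuallyEq (Filter.Eventually.of_forall fun t => ?_))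
  have h2 : NormedSpace.exp (t • X) * NormedSpace.exp (-(t • X)) = 1 := by
    rw [← NormedSpace.exp_add_of_commute (Commute.refl (t • X)).neg_right]; simp
  have h3 : NormedSpace.exp (-(t • X)) * NormedSpace.exp (t • X) = 1 := by
    rw [← NormedSpace.exp_add_of_commute (Commute.refl (t • X)).neg_left]; simp
  exact NormedSpace.exp_units_conj ⟨_, _, h2, h3⟩ A

end Exponential

/-! ### The Levi-Civita connection in coordinates and the Ricci identity. -/

section Coordinates

theorem two_le_infty : (1 + 1 : WithTop ℕ∞) ≤ ∞ := by
  rw [one_add_one_eq_two]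
  exact ENat.LEInfty.out

variable {E : Type} [NormedAddCommGroup E] [NormedSpace ℝ E]
  {F : Type} [NormedAddCommGroup F] [NormedSpace ℝ F]

theorem fderiv_comp_apply {E₁ E₂ E₃ : Type*} [NormedAddCommGroup E₁] [NormedSpace ℝ E₁]
    [NormedAddCommGroup E₂] [NormedSpace ℝ E₂] [NormedAddCommGroup E₃] [NormedSpace ℝ E₃]
    {A : E → E₂ →L[ℝ] E₃} {B : E → E₁ →L[ℝ] E₂} {y : E} (hA : DifferentiableAt ℝ A y)
    (hB : DifferentiableAt ℝ B y) (ξ : E) :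
    fderiv ℝ (fun z => A z ∘L B z) y ξ = A y ∘L fderiv ℝ B y ξ + fderiv ℝ A y ξ ∘L B y := by
  rw [fderiv_clm_comp hA hB]
  simp

theorem fderiv_eval {E₁ E₂ : Type*} [NormedAddCommGroup E₁] [NormedSpace ℝ E₁]
    [NormedAddCommGroup E₂] [NormedSpace ℝ E₂]
    {A : E → E₁ →L[ℝ] E₂} {y : E} (hA : DifferentiableAt ℝ A y) (ξ : E) (x : E₁) :
    fderiv ℝ (fun z => A z x) y ξ = fderiv ℝ A y ξ x := by
  rw [fderiv_clm_apply hA (differentiableAt_const x)]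
  simp

/-- A smooth metric over the open set `U`. -/
structure IsMetricOn (U : Set E) (g : E → E →L[ℝ] E →L[ℝ] ℝ) : Prop where
  isOpen : IsOpen U
  contDiffOn : ContDiffOn ℝ ∞ g U
  isScalarProduct : ∀ y ∈ U, IsScalarProduct (g y)

theorem cov_end_apply (g : E → E →L[ℝ] E →L[ℝ] ℝ) (A : E → E →L[ℝ] E) (y ξ : E) :
    cov (actEnd E) g A y ξ =
      fderiv ℝ A y ξ + (christoffel g y ξ * A y - A y * christoffel g y ξ) := by
  ext; simp [cov, actHom, actV]

theorem cov_hom_apply (ρ : TensorAction E F) (g : E → E →L[ℝ] E →L[ℝ] ℝ) (A : E → E →L[ℝ] F)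
    (y ξ η : E) :
    cov (actHom ρ) g A y ξ η =
      fderiv ℝ A y ξ η + ρ (christoffel g y ξ) (A y η) - A y (christoffel g y ξ η) := by
  simp [cov, actHom, add_sub_assoc]

theorem actEnd_apply (L A : E →L[ℝ] E) : actEnd E L A = L * A - A * L := by
  ext; simp [actHom, actV]

theorem cov_actR (g : E → E →L[ℝ] E →L[ℝ] ℝ) (u : E → ℝ) (y : E) :
    cov (actR E) g u y = fderiv ℝ u y := by
  ext; simp [cov, actR]

theorem curvature_apply (g : E → E →L[ℝ] E →L[ℝ] ℝ) (y ξ η : E) :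
    curvature g y ξ η = fderiv ℝ (christoffel g) y ξ η - fderiv ℝ (christoffel g) y η ξ
      + (christoffel g y ξ * christoffel g y η - christoffel g y η * christoffel g y ξ) := by
  simp [curvature]; rfl

theorem hessian_apply (g : E → E →L[ℝ] E →L[ℝ] ℝ) (u : E → ℝ) (y ξ η : E) :
    hessian g u y ξ η = fderiv ℝ (fderiv ℝ u) y ξ η - fderiv ℝ u y (christoffel g y ξ η) := by
  have : cov (actR E) g u = fderiv ℝ u := funext (cov_actR g u)
  rw [hessian, this, cov_hom_apply]
  simp [actR]

variable [FiniteDimensional ℝ E] {U : Set E} {g : E → E →L[ℝ] E →L[ℝ] ℝ} {y : E}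

theorem IsMetricOn.mem_nhds (hg : IsMetricOn U g) (hy : y ∈ U) : U ∈ 𝓝 y :=
  hg.isOpen.mem_nhds hy

theorem IsMetricOn.differentiableAt (hg : IsMetricOn U g) (hy : y ∈ U) : DifferentiableAt ℝ g y :=
  (hg.contDiffOn.contDiffAt (hg.mem_nhds hy)).differentiableAt (by simp)

theorem IsMetricOn.fderiv_symm (hg : IsMetricOn U g) (hy : y ∈ U) (ξ η ζ : E) :
    fderiv ℝ g y ξ η ζ = fderiv ℝ g y ξ ζ η := by
  have hd := hg.differentiableAt hy
  have h : (fun z => g z η ζ) =ᶠ[𝓝 y] fun z => g z ζ η := by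
    filter_upwards [hg.mem_nhds hy] with z hz using (hg.isScalarProduct z hz).symm η ζ
  have h1 := h.fderiv_eq (𝕜 := ℝ)
  have h2 : ∀ η ζ : E, fderiv ℝ (fun z => g z η ζ) y ξ = fderiv ℝ g y ξ η ζ := by
    intro η ζ
    rw [fderiv_eval (A := fun z => g z η) (hd.clm_apply (differentiableAt_const η)), fderiv_eval hd]
  rw [← h2, ← h2, h1]

theorem christoffel_apply (hg : IsScalarProduct (g y)) (ξ η ζ : E) :
    g y (christoffel g y ξ η) ζ =
      1 / 2 * (fderiv ℝ g y ξ η ζ + fderiv ℝ g y η ξ ζ - fderiv ℝ g y ζ ξ η) := by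
  simp only [christoffel, ContinuousLinearMap.coe_comp, Function.comp_apply, map_smul, ContinuousLinearMap.compL_apply, smul_apply, hg.inverse_apply_left]
  simp

theorem eq_of_apply_eq (hg : IsScalarProduct (g y)) {ξ η : E} (h : ∀ ζ, g y ξ ζ = g y η ζ) :
    ξ = η := by
  rw [← hg.inverse_apply_right ξ, ← hg.inverse_apply_right η]
  congr 1
  ext ζ
  exact h ζ

theorem IsMetricOn.christoffel_symm (hg : IsMetricOn U g) (hy : y ∈ U) (ξ η : E) :
    christoffel g y ξ η = christoffel g y η ξ := by
  refine eq_of_apply_eq (hg.isScalarProduct y hy) fun ζ => ?_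
  rw [christoffel_apply (hg.isScalarProduct y hy), christoffel_apply (hg.isScalarProduct y hy),
    hg.fderiv_symm hy ζ ξ η]
  ring

theorem IsMetricOn.fderiv_apply (hg : IsMetricOn U g) (hy : y ∈ U) (ξ η ζ : E) :
    fderiv ℝ g y ξ η ζ = g y (christoffel g y ξ η) ζ + g y η (christoffel g y ξ ζ) := by
  have hs := hg.isScalarProduct y hy
  rw [hs.symm η, christoffel_apply hs, christoffel_apply hs, hg.fderiv_symm hy ξ ζ η,
    hg.fderiv_symm hy ζ ξ η, hg.fderiv_symm hy η ξ ζ]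
  ring

/-- The Levi-Civita connection is the torsion free connection which preserves the metric. -/
theorem IsMetricOn.eq_christoffel (hg : IsMetricOn U g) (hy : y ∈ U) (C : E →L[ℝ] E →L[ℝ] E)
    (hsymm : ∀ ξ η, C ξ η = C η ξ)
    (hC : ∀ ξ η ζ, fderiv ℝ g y ξ η ζ = g y (C ξ η) ζ + g y η (C ξ ζ)) :
    christoffel g y = C := by
  have hs := hg.isScalarProduct y hy
  ext1 ξ
  ext1 η
  refine eq_of_apply_eq hs fun ζ => ?_
  rw [christoffel_apply hs, hC, hC, hC, hsymm η ξ, hsymm ζ ξ, hsymm ζ η, hs.symm η,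
    hs.symm ξ]
  ring

theorem IsMetricOn.contDiffOn_inverse (hg : IsMetricOn U g) :
    ContDiffOn ℝ ∞ (fun z => (g z).inverse) U := by
  intro z hz
  obtain ⟨e, he⟩ := (hg.isScalarProduct z hz).isInvertible
  have h1 : ContDiffAt ℝ ∞ ContinuousLinearMap.inverse (g z) := he ▸ contDiffAt_map_inverse e
  exact h1.comp_contDiffWithinAt z (hg.contDiffOn z hz)

theorem IsMetricOn.contDiffOn_christoffel (hg : IsMetricOn U g) :
    ContDiffOn ℝ ∞ (christoffel g) U := by
  have h1 : ContDiffOn ℝ ∞ (fderiv ℝ g) U := hg.contDiffOn.fderiv_of_isOpen hg.isOpen (by simp)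
  have hi := hg.contDiffOn_inverse
  have h2 : ContDiffOn ℝ ∞ (fun z => (fderiv ℝ g z).flip) U :=
    (ContinuousLinearMap.flipₗᵢ ℝ E E (E →L[ℝ] ℝ)).contDiff.comp_contDiffOn h1
  have h3 : ContDiffOn ℝ ∞ (fun z => ContinuousLinearMap.compL ℝ E (E →L[ℝ] ℝ) E (g z).inverse) U :=
    (ContinuousLinearMap.compL ℝ E (E →L[ℝ] ℝ) E).contDiff.comp_contDiffOn hi
  exact (h3.clm_comp ((h1.add h2).sub (contDiffOn_const.clm_comp h2))).const_smul (1 / 2 : ℝ)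

theorem IsMetricOn.differentiableAt_christoffel (hg : IsMetricOn U g) (hy : y ∈ U) :
    DifferentiableAt ℝ (christoffel g) y :=
  (hg.contDiffOn_christoffel.contDiffAt (hg.mem_nhds hy)).differentiableAt (by simp)

theorem IsMetricOn.contDiffOn_cov (hg : IsMetricOn U g) (ρ : TensorAction E F) {A : E → F}
    (hA : ContDiffOn ℝ ∞ A U) : ContDiffOn ℝ ∞ (cov ρ g A) U := by
  have h1 : ContDiffOn ℝ ∞ (fderiv ℝ A) U := hA.fderiv_of_isOpen hg.isOpen (by simp)
  exact h1.add (ContDiffOn.clm_comp (ρ.flip.contDiff.comp_contDiffOn hA) hg.contDiffOn_christoffel)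

theorem cov_congr (ρ : TensorAction E F) {A B : E → F} (h : A =ᶠ[𝓝 y] B) :
    cov ρ g A y = cov ρ g B y := by
  simp [cov, h.fderiv_eq, h.eq_of_nhds]

theorem cov_mul {A B : E → E →L[ℝ] E} (hA : DifferentiableAt ℝ A y) (hB : DifferentiableAt ℝ B y)
    (ξ : E) : cov (actEnd E) g (fun z => A z * B z) y ξ =
      cov (actEnd E) g A y ξ * B y + A y * cov (actEnd E) g B y ξ := by
  have h := fderiv_comp_apply hA hB ξ
  simp only [cov_end_apply]
  rw [show (fun z => A z * B z) = fun z => A z ∘L B z from rfl, h]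
  simp only [← ContinuousLinearMap.mul_def]
  noncomm_ring

theorem cov_smul {A : E → E →L[ℝ] E} (hA : DifferentiableAt ℝ A y) (r : ℝ) (ξ : E) :
    cov (actEnd E) g (fun z => r • A z) y ξ = r • cov (actEnd E) g A y ξ := by
  simp only [cov_end_apply, fderiv_fun_const_smul hA, smul_apply, mul_smul_comm, smul_mul_assoc]
  module

theorem cov_hom_end_apply {A : E → E →L[ℝ] E →L[ℝ] E} (hA : DifferentiableAt ℝ A y) (ξ η : E) :
    cov (actHom (actEnd E)) g A y ξ η =
      cov (actEnd E) g (fun z => A z η) y ξ - A y (christoffel g y ξ η) := by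
  rw [cov_hom_apply, cov_end_apply, actEnd_apply, fderiv_eval hA]

/-- The derivative of `g (A η, ζ) = g (η, A ζ)`, the metric being parallel. -/
theorem IsMetricOn.cov_selfAdjoint (hg : IsMetricOn U g) (hy : y ∈ U) {A : E → E →L[ℝ] E}
    (hA : DifferentiableAt ℝ A y) (h : ∀ z ∈ U, ∀ η ζ, g z (A z η) ζ = g z η (A z ζ)) (ξ η ζ : E) :
    g y (cov (actEnd E) g A y ξ η) ζ = g y η (cov (actEnd E) g A y ξ ζ) := by
  have hd := hg.differentiableAt hy
  have hs := hg.isScalarProduct y hy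
  have h1 : ∀ η ζ, fderiv ℝ (fun z => g z (A z η) ζ) y ξ =
      fderiv ℝ g y ξ (A y η) ζ + g y (fderiv ℝ A y ξ η) ζ := by
    intro η ζ
    have hAη : DifferentiableAt ℝ (fun z => A z η) y := hA.clm_apply (differentiableAt_const η)
    rw [fderiv_eval (A := fun z => g z (A z η)) (hd.clm_apply hAη), fderiv_clm_apply hd hAη]
    simp [fderiv_eval hA, add_comm]
  have h2 : (fun z => g z (A z η) ζ) =ᶠ[𝓝 y] fun z => g z (A z ζ) η := by
    filter_upwards [hg.mem_nhds hy] with z hz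
    rw [h z hz, (hg.isScalarProduct z hz).symm]
  have h3 := congrArg (fun T : E →L[ℝ] ℝ => T ξ) (h2.fderiv_eq (𝕜 := ℝ))
  simp only [h1, hg.fderiv_apply hy] at h3
  simp only [cov_end_apply, add_apply, sub_apply, map_add, map_sub, mul_apply_eq_comp]
  have e1 := h y hy (christoffel g y ξ η) ζ
  have e2 := h y hy η (christoffel g y ξ ζ)
  have e3 := hs.symm (fderiv ℝ A y ξ ζ) η
  have e4 := hs.symm (A y ζ) (christoffel g y ξ η)
  have e5 := hs.symm (christoffel g y ξ (A y ζ)) η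
  linarith

theorem extCov_eq_zero_iff {A : E → E →L[ℝ] E} {ξ η : E} :
    extCov g A y ξ η = 0 ↔ cov (actEnd E) g A y ξ η = cov (actEnd E) g A y η ξ :=
  sub_eq_zero

/-- The Ricci identity. -/
theorem IsMetricOn.cov_cov_sub (hg : IsMetricOn U g) (hy : y ∈ U) {A : E → E →L[ℝ] E}
    (hA : ContDiffOn ℝ ∞ A U) (ξ η : E) :
    cov (actHom (actEnd E)) g (cov (actEnd E) g A) y ξ η
      - cov (actHom (actEnd E)) g (cov (actEnd E) g A) y η ξ =
      curvature g y ξ η * A y - A y * curvature g y ξ η := by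
  have hAt := hA.contDiffAt (hg.mem_nhds hy)
  have hA1 : DifferentiableAt ℝ A y := hAt.differentiableAt (by simp)
  have hA2 : DifferentiableAt ℝ (fderiv ℝ A) y :=
    (hAt.fderiv_right (m := 1) two_le_infty).differentiableAt (by simp)
  have hΓ := hg.differentiableAt_christoffel hy
  have hN : DifferentiableAt ℝ (cov (actEnd E) g A) y :=
    ((hg.contDiffOn_cov _ hA).contDiffAt (hg.mem_nhds hy)).differentiableAt (by simp)
  have hsymm : fderiv ℝ (fderiv ℝ A) y ξ η = fderiv ℝ (fderiv ℝ A) y η ξ :=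
    (hAt.isSymmSndFDerivAt (by simpa using ENat.LEInfty.out)) ξ η
  have key : ∀ ξ η, fderiv ℝ (fun z => cov (actEnd E) g A z η) y ξ =
      fderiv ℝ (fderiv ℝ A) y ξ η
      + (christoffel g y η * fderiv ℝ A y ξ + fderiv ℝ (christoffel g) y ξ η * A y
        - (A y * fderiv ℝ (christoffel g) y ξ η + fderiv ℝ A y ξ * christoffel g y η)) := by
    intro ξ η
    have hΓη : DifferentiableAt ℝ (fun z => christoffel g z η) y :=
      hΓ.clm_apply (differentiableAt_const η)
    have e1 := fderiv_comp_apply hΓη hA1 ξ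
    have e2 := fderiv_comp_apply hA1 hΓη ξ
    rw [fderiv_eval hΓ] at e1 e2
    have e3 : (fun z => cov (actEnd E) g A z η) = fun z => fderiv ℝ A z η +
      ((christoffel g z η) ∘L A z - A z ∘L (christoffel g z η)) := funext fun z => cov_end_apply g A z η
    rw [e3, fderiv_fun_add (hA2.clm_apply (differentiableAt_const η))
      (DifferentiableAt.fun_sub (hΓη.clm_comp hA1) (hA1.clm_comp hΓη)),
      fderiv_fun_sub (hΓη.clm_comp hA1) (hA1.clm_comp hΓη),
      add_apply, sub_apply, e1, e2, fderiv_eval hA2]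
    rfl
  -- The second derivatives of `A` cancel by their symmetry and the terms in `Γ ξ η` by absence of
  -- torsion; the rest assembles into the commutator of the curvature with `A`.
  rw [cov_hom_end_apply hN, cov_hom_end_apply hN, hg.christoffel_symm hy η ξ, 
    cov_end_apply g (fun z => cov (actEnd E) g A z η),
    cov_end_apply g (fun z => cov (actEnd E) g A z ξ), key, key, cov_end_apply g A y ξ,
    cov_end_apply g A y η,
    curvature_apply, hsymm]
  noncomm_ring

end Coordinates

/-! ### Exponentials of self-adjoint endomorphisms. -/

section Exponential

variable {E : Type*} [NormedAddCommGroup E] [NormedSpace ℝ E] [FiniteDimensional ℝ E]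
  {g : E →L[ℝ] E →L[ℝ] ℝ} {A : E →L[ℝ] E}

theorem expEnd_selfAdjoint (h : ∀ x y, g (A x) y = g x (A y)) (x y : E) :
    g (expEnd A x) y = g x (expEnd A y) := by
  have hk : ∀ (k : ℕ) (x y : E), g ((A ^ k) x) y = g x ((A ^ k) y) := by
    intro k
    induction k with
    | zero => simp
    | succ k ih =>
      intro x y
      rw [pow_succ', mul_apply_eq_comp, h, ih, ← mul_apply_eq_comp, ← pow_succ, pow_succ']
  have hs := NormedSpace.exp_series_hasSum_exp' (𝕂 := ℝ) A
  have h1 := (((ContinuousLinearMap.apply ℝ ℝ y) ∘L g ∘L (ContinuousLinearMap.apply ℝ E x))).hasSum hs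
  have h2 := ((g x) ∘L (ContinuousLinearMap.apply ℝ E y)).hasSum hs
  refine h1.unique ?_
  convert! h2 using 2 with k
  simp only [ContinuousLinearMap.comp_apply, map_smul, ContinuousLinearMap.apply_apply, hk]

/-- Positivity comes from `g (exp A x, x) = g (exp (A/2) x, exp (A/2) x)` and the invertibility of
`exp (A/2)`. -/
theorem IsScalarProduct.comp_expEnd (hg : IsScalarProduct g)
    (h : ∀ x y, g (A x) y = g x (A y)) : IsScalarProduct (g ∘L expEnd A) where
  symm x y := (expEnd_selfAdjoint h x y).trans (hg.symm _ _)
  pos x hx := by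
    have h1 : expEnd A = expEnd ((1 / 2 : ℝ) • A) * expEnd ((1 / 2 : ℝ) • A) := by
      rw [← expEnd_add (Commute.refl _), ← add_smul]; norm_num
    have h2 : expEnd ((-(1 / 2) : ℝ) • A) * expEnd ((1 / 2 : ℝ) • A) = 1 := by
      rw [← expEnd_add (((Commute.refl A).smul_left _).smul_right _), ← add_smul]
      simp [expEnd_zero]
    have h3 : ∀ x y, g (((1 / 2 : ℝ) • A) x) y = g x (((1 / 2 : ℝ) • A) y) := by
      intro x y; simp [h]
    rw [ContinuousLinearMap.comp_apply, h1, mul_apply_eq_comp, expEnd_selfAdjoint h3]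
    refine hg.pos _ fun h0 => hx ?_
    have := congrArg (fun T : E →L[ℝ] E => T x) h2
    rw [mul_apply_eq_comp, h0, map_zero] at this
    exact this.symm

end Exponential

/-! ### Connection and curvature of the metric `g exp L`. -/

section Coordinates

variable {E : Type} [NormedAddCommGroup E] [NormedSpace ℝ E] [FiniteDimensional ℝ E]
  {U : Set E} {g : E → E →L[ℝ] E →L[ℝ] ℝ} {L : E → E →L[ℝ] E} {y : E}

/-- Write `D_ξ A = ∇_ξ A - [Γ_ξ, A]`. The differential of the exponential sends the first term to
`exp A ∇_ξ A` and the second to `-[Γ_ξ, exp A]`, which the zeroth order term of `∇_ξ exp A` cancels.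
-/
theorem cov_expEnd {A : E → E →L[ℝ] E} (hA : DifferentiableAt ℝ A y) {ξ : E}
    (hc : Commute (A y) (cov (actEnd E) g A y ξ)) :
    cov (actEnd E) g (fun z => expEnd (A z)) y ξ =
      expEnd (A y) * cov (actEnd E) g A y ξ := by
  have hd : HasFDerivAt (expEnd : (E →L[ℝ] E) → _) (fderiv ℝ expEnd (A y)) (A y) :=
    (contDiff_expEnd.differentiable (by simp) (A y)).hasFDerivAt
  have h1 : fderiv ℝ (fun z => expEnd (A z)) y = fderiv ℝ expEnd (A y) ∘L fderiv ℝ A y :=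
    (hd.comp y hA.hasFDerivAt).fderiv
  have h2 : fderiv ℝ A y ξ = cov (actEnd E) g A y ξ -
      (christoffel g y ξ * A y - A y * christoffel g y ξ) := by
    rw [cov_end_apply]; abel
  rw [cov_end_apply, h1, ContinuousLinearMap.comp_apply, h2, map_sub, fderiv_expEnd_of_commute hc,
    fderiv_expEnd_commutator]
  abel

variable (U g L) in
/-- A self-adjoint Codazzi field `L` of endomorphisms which commutes with the curvature and with
its covariant derivatives, which commute with each other. -/
structure IsCommutingLog : Prop where
  metric : IsMetricOn U g
  contDiffOn : ContDiffOn ℝ ∞ L U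
  selfAdjoint : ∀ z ∈ U, ∀ η ζ, g z (L z η) ζ = g z η (L z ζ)
  codazzi : ∀ z ∈ U, ∀ ξ η, cov (actEnd E) g L z ξ η = cov (actEnd E) g L z η ξ
  commute_curvature : ∀ z ∈ U, ∀ ξ η, Commute (curvature g z ξ η) (L z)
  commute_cov : ∀ z ∈ U, ∀ ξ, Commute (L z) (cov (actEnd E) g L z ξ)
  commute_cov_cov : ∀ z ∈ U, ∀ ξ η,
    Commute (cov (actEnd E) g L z ξ) (cov (actEnd E) g L z η)

namespace IsCommutingLog

theorem differentiableAt (h : IsCommutingLog U g L) (hy : y ∈ U) : DifferentiableAt ℝ L y :=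
  (h.contDiffOn.contDiffAt (h.metric.mem_nhds hy)).differentiableAt (by simp)

theorem contDiffOn_cov (h : IsCommutingLog U g L) : ContDiffOn ℝ ∞ (cov (actEnd E) g L) U :=
  h.metric.contDiffOn_cov _ h.contDiffOn

theorem differentiableAt_cov (h : IsCommutingLog U g L) (hy : y ∈ U) :
    DifferentiableAt ℝ (cov (actEnd E) g L) y :=
  (h.contDiffOn_cov.contDiffAt (h.metric.mem_nhds hy)).differentiableAt (by simp)

theorem contDiffOn_exp (h : IsCommutingLog U g L) (r : ℝ) :
    ContDiffOn ℝ ∞ (fun z => expEnd (r • L z)) U :=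
  contDiff_expEnd.comp_contDiffOn (h.contDiffOn.const_smul r)

theorem cov_exp (h : IsCommutingLog U g L) (hy : y ∈ U) (r : ℝ) (ξ : E) :
    cov (actEnd E) g (fun z => expEnd (r • L z)) y ξ =
      r • (expEnd (r • L y) * cov (actEnd E) g L y ξ) := by
  have hd := h.differentiableAt hy
  have h1 := cov_smul (g := g) hd r ξ
  rw [cov_expEnd (A := fun z => r • L z) (hd.const_smul r), h1, mul_smul_comm]
  rw [h1]
  exact ((h.commute_cov y hy ξ).smul_left r).smul_right r

/-- The metric `g exp L`. -/
theorem isMetricOn (h : IsCommutingLog U g L) : IsMetricOn U fun z => g z ∘L expEnd (L z) where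
  isOpen := h.metric.isOpen
  contDiffOn := h.metric.contDiffOn.clm_comp (contDiff_expEnd.comp_contDiffOn h.contDiffOn)
  isScalarProduct z hz := (h.metric.isScalarProduct z hz).comp_expEnd (h.selfAdjoint z hz)

theorem cov_selfAdjoint (h : IsCommutingLog U g L) (hy : y ∈ U) (ξ η ζ : E) :
    g y (cov (actEnd E) g L y ξ η) ζ = g y η (cov (actEnd E) g L y ξ ζ) :=
  h.metric.cov_selfAdjoint hy (h.differentiableAt hy) h.selfAdjoint ξ η ζ

/-- By uniqueness of the Levi-Civita connection. Symmetry of `∇L` is the Codazzi equation; the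
metric is preserved because `g (exp L ∇_ξ L η, ζ)` splits into two equal halves, `∇_ξ L` being
self-adjoint and commuting with `exp L`. -/
theorem christoffel_eq (h : IsCommutingLog U g L) (hy : y ∈ U) :
    christoffel (fun z => g z ∘L expEnd (L z)) y =
      christoffel g y + (1 / 2 : ℝ) • cov (actEnd E) g L y := by
  have hg := h.metric
  refine h.isMetricOn.eq_christoffel hy _ (fun ξ η => ?_) fun ξ η ζ => ?_
  · simp [hg.christoffel_symm hy ξ η, h.codazzi y hy ξ η]
  · have hB : DifferentiableAt ℝ (fun z => expEnd (L z)) y :=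
      ((contDiff_expEnd.comp_contDiffOn h.contDiffOn).contDiffAt (hg.mem_nhds hy)).differentiableAt
        (by simp)
    have h1 := cov_expEnd (g := g) (h.differentiableAt hy) (h.commute_cov y hy ξ)
    rw [cov_end_apply] at h1
    have h2 : fderiv ℝ (fun z => expEnd (L z)) y ξ = expEnd (L y) * cov (actEnd E) g L y ξ -
      (christoffel g y ξ * expEnd (L y) - expEnd (L y) * christoffel g y ξ) := eq_sub_of_add_eq h1
    have h3 := congrArg (fun T : E →L[ℝ] E => T η)
      (commute_expEnd (h.commute_cov y hy ξ).symm).eq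
    have h4 := h.cov_selfAdjoint hy ξ (expEnd (L y) η) ζ
    simp only [mul_apply_eq_comp] at h3
    rw [fderiv_comp_apply (hg.differentiableAt hy) hB, h2]
    simp only [add_apply, ContinuousLinearMap.comp_apply, sub_apply, mul_apply_eq_comp, smul_apply,
      map_add, map_sub, map_smul, hg.fderiv_apply hy, ← h4, h3, smul_eq_mul]
    ring

/-- The Ricci identity, whose right-hand side `[R, L]` vanishes. -/
theorem cov_cov_comm (h : IsCommutingLog U g L) (hy : y ∈ U) (ξ η : E) :
    cov (actHom (actEnd E)) g (cov (actEnd E) g L) y ξ η =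
      cov (actHom (actEnd E)) g (cov (actEnd E) g L) y η ξ := by
  have h1 := h.metric.cov_cov_sub hy h.contDiffOn ξ η
  rw [(h.commute_curvature y hy ξ η).eq, sub_self] at h1
  exact sub_eq_zero.1 h1

/-- The covariant derivative of the Codazzi equation. With `cov_cov_comm` it makes `∇²L` symmetric
in all three vector arguments. -/
theorem cov_cov_codazzi (h : IsCommutingLog U g L) (hy : y ∈ U) (ξ η ζ : E) :
    cov (actHom (actEnd E)) g (cov (actEnd E) g L) y ξ η ζ =
      cov (actHom (actEnd E)) g (cov (actEnd E) g L) y ξ ζ η := by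
  have hN := h.differentiableAt_cov hy
  have h1 : (fun z => cov (actEnd E) g L z η ζ) =ᶠ[𝓝 y] fun z => cov (actEnd E) g L z ζ η := by
    filter_upwards [h.metric.mem_nhds hy] with z hz using h.codazzi z hz η ζ
  have h2 := congrArg (fun T : E →L[ℝ] E => T ξ) (h1.fderiv_eq (𝕜 := ℝ))
  have h3 : ∀ η ζ, fderiv ℝ (fun z => cov (actEnd E) g L z η ζ) y ξ =
      fderiv ℝ (cov (actEnd E) g L) y ξ η ζ := by
    intro η ζ
    rw [fderiv_eval (A := fun z => cov (actEnd E) g L z η)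
      (hN.clm_apply (differentiableAt_const η)), fderiv_eval hN]
  simp only [h3] at h2
  rw [cov_hom_apply, cov_hom_apply, actEnd_apply, actEnd_apply]
  simp only [add_apply, sub_apply, mul_apply_eq_comp, h2]
  rw [h.codazzi y hy η ζ, h.codazzi y hy (christoffel g y ξ η) ζ,
    h.codazzi y hy (christoffel g y ξ ζ) η]
  abel

theorem cov_cov_selfAdjoint (h : IsCommutingLog U g L) (hy : y ∈ U) (ξ η ζ θ : E) :
    g y (cov (actHom (actEnd E)) g (cov (actEnd E) g L) y ξ η ζ) θ =
      g y ζ (cov (actHom (actEnd E)) g (cov (actEnd E) g L) y ξ η θ) := by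
  have hN := h.differentiableAt_cov hy
  rw [cov_hom_end_apply hN]
  simp only [sub_apply, map_sub, h.cov_selfAdjoint hy]
  rw [h.metric.cov_selfAdjoint hy (A := fun z => cov (actEnd E) g L z η)
    (hN.clm_apply (differentiableAt_const η)) (fun z hz => h.cov_selfAdjoint hz η)]

/-- The metrics `g` and `g exp L` have the same curvature. -/
theorem curvature_eq (h : IsCommutingLog U g L) (hy : y ∈ U) :
    curvature (fun z => g z ∘L expEnd (L z)) y = curvature g y := by
  have hN := h.differentiableAt_cov hy
  have hΓ := h.metric.differentiableAt_christoffel hy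
  have h1 : christoffel (fun z => g z ∘L expEnd (L z)) =ᶠ[𝓝 y] fun z =>
      christoffel g z + (1 / 2 : ℝ) • cov (actEnd E) g L z := by
    filter_upwards [h.metric.mem_nhds hy] with z hz using h.christoffel_eq hz
  have h2 : ∀ ξ η, fderiv ℝ (cov (actEnd E) g L) y ξ η =
      cov (actHom (actEnd E)) g (cov (actEnd E) g L) y ξ η
      - (christoffel g y ξ * cov (actEnd E) g L y η - cov (actEnd E) g L y η * christoffel g y ξ)
      + cov (actEnd E) g L y (christoffel g y ξ η) := by
    intro ξ η
    rw [cov_hom_apply, actEnd_apply]; abel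
  ext1 ξ
  ext1 η
  rw [curvature_apply, curvature_apply, h1.fderiv_eq, h.christoffel_eq hy,
    fderiv_fun_add hΓ (hN.fun_const_smul (1 / 2 : ℝ)), fderiv_fun_const_smul hN]
  -- The change of curvature is half the antisymmetrization of `∇²L` plus a quarter of `[∇_ξ L, ∇_η
  -- L]`; both vanish.
  simp only [add_apply, smul_apply, h2, h.cov_cov_comm hy ξ η, h.metric.christoffel_symm hy ξ η,
    add_mul, mul_add, smul_mul_assoc, mul_smul_comm, (h.commute_cov_cov y hy ξ η).eq]
  module

end IsCommutingLog

end Coordinates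

/-! ### The Bakry-Emery-Ricci tensor of `g exp L`. -/

section Coordinates

variable {E : Type} [NormedAddCommGroup E] [NormedSpace ℝ E] [FiniteDimensional ℝ E]
  {F : Type} [NormedAddCommGroup F] [NormedSpace ℝ F]
  {U : Set E} {g : E → E →L[ℝ] E →L[ℝ] ℝ} {L : E → E →L[ℝ] E} {w : E → ℝ} {y : E}
  {n : ℕ} (b : Module.Basis (Fin n) ℝ E)

variable (E) in
/-- The trace of an endomorphism. -/
def traceEnd : (E →L[ℝ] E) →L[ℝ] ℝ :=
  LinearMap.toContinuousLinearMap (LinearMap.trace ℝ E ∘ₗ ContinuousLinearMap.coeLM ℝ)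

theorem traceEnd_apply (A : E →L[ℝ] E) : traceEnd E A = LinearMap.trace ℝ E A := rfl

theorem traceEnd_mul_comm (A B : E →L[ℝ] E) : traceEnd E (A * B) = traceEnd E (B * A) :=
  LinearMap.trace_mul_comm ℝ (A : E →ₗ[ℝ] E) (B : E →ₗ[ℝ] E)

/-- Expresses the trace through the vectors used by `trg`, so that the two kinds of trace can be
compared term by term. -/
theorem IsScalarProduct.traceEnd_eq_sum {s : E →L[ℝ] E →L[ℝ] ℝ} (hs : IsScalarProduct s)
    (A : E →L[ℝ] E) : traceEnd E A = ∑ i, s (s.inverse (dualForm b i)) (A (b i)) := by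
  rw [traceEnd_apply, LinearMap.trace_eq_matrix_trace ℝ b, Matrix.trace]
  refine Finset.sum_congr rfl fun i _ => ?_
  rw [hs.inverse_apply_left, Matrix.diag_apply, LinearMap.toMatrix_apply]
  rfl

theorem traceEnd_cov {A : E → E →L[ℝ] E} (ξ : E) :
    traceEnd E (cov (actEnd E) g A y ξ) = traceEnd E (fderiv ℝ A y ξ) := by
  rw [cov_end_apply, map_add, map_sub, traceEnd_mul_comm, sub_self, add_zero]

theorem IsScalarProduct.det_pos {s : E →L[ℝ] E →L[ℝ] ℝ} (hs : IsScalarProduct s) :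
    0 < (Matrix.of fun i j : Fin n => s (b i) (b j)).det := by
  refine Matrix.PosDef.det_pos (Matrix.PosDef.of_dotProduct_mulVec_pos ?_ fun x hx => ?_)
  · ext i j
    simp [hs.symm (b i)]
  · have h1 : star x ⬝ᵥ (Matrix.of fun i j : Fin n => s (b i) (b j)).mulVec x =
        s (∑ i, x i • b i) (∑ j, x j • b j) := by
      simp only [map_sum, map_smul, dotProduct, Matrix.mulVec, Matrix.of_apply, sum_apply,
        smul_apply, smul_eq_mul, star_trivial, Finset.mul_sum]
      rw [Finset.sum_comm]
      refine Finset.sum_congr rfl fun i _ => Finset.sum_congr rfl fun j _ => ?_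
      ring
    rw [h1]
    refine hs.pos _ fun h0 => hx ?_
    ext i
    exact Fintype.linearIndependent_iff.1 b.linearIndependent x h0 i

theorem IsMetricOn.contDiffOn_logDensity (hg : IsMetricOn U g) (hw : ContDiffOn ℝ ∞ w U)
    (hw0 : ∀ z ∈ U, w z ≠ 0) : ContDiffOn ℝ ∞ (logDensity b g w) U := by
  have h1 : ContDiffOn ℝ ∞ (fun z => (Matrix.of fun i j : Fin n => g z (b i) (b j)).det) U := by
    simp only [Matrix.det_apply]
    refine ContDiffOn.sum fun σ _ => ContDiffOn.const_smul _ (contDiffOn_prod fun i _ => ?_)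
    exact (hg.contDiffOn.clm_apply contDiffOn_const).clm_apply contDiffOn_const
  intro z hz
  have hd := (hg.isScalarProduct z hz).det_pos b
  have h2 : ContDiffWithinAt ℝ ∞ (fun z => |w z|) U z :=
    (contDiffAt_abs (hw0 z hz)).comp_contDiffWithinAt z (hw z hz)
  exact ((ContDiffWithinAt.sqrt (h1 z hz) hd.ne').div h2 (abs_ne_zero.2 (hw0 z hz))).log
    (div_ne_zero (Real.sqrt_ne_zero'.2 hd) (abs_ne_zero.2 (hw0 z hz)))

theorem omegaLaplacian_end_apply (A : E → E →L[ℝ] E) :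
    omegaLaplacian b w (actEnd E) g A y =
      - ∑ i, cov (actHom (actEnd E)) g (cov (actEnd E) g A) y (b i) ((g y).inverse (dualForm b i))
      + cov (actEnd E) g A y (gradient g (logDensity b g w) y) := rfl

/-- The metric is parallel, so lowering an index commutes with `∇`. -/
theorem cov_bil_apply (hg : IsMetricOn U g) (hy : y ∈ U) {A : E → E →L[ℝ] E}
    (hA : DifferentiableAt ℝ A y) (ξ : E) :
    cov (actBil E) g (fun z => g z ∘L A z) y ξ = g y ∘L cov (actEnd E) g A y ξ := by
  ext η ζ
  rw [cov_hom_apply, fderiv_comp_apply (hg.differentiableAt hy) hA, cov_end_apply]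
  simp [hg.fderiv_apply hy, actHom, actR]
  ring

theorem cov_hom_eq_cov_eval (ρ : TensorAction E F) {A : E → E →L[ℝ] F}
    (hA : DifferentiableAt ℝ A y) (ξ η : E) :
    cov (actHom ρ) g A y ξ η = cov ρ g (fun z => A z η) y ξ - A y (christoffel g y ξ η) := by
  rw [cov_hom_apply, cov, add_apply, fderiv_eval hA]
  rfl

theorem cov_hom_bil_apply (hg : IsMetricOn U g) (hy : y ∈ U) {A : E → E →L[ℝ] E →L[ℝ] E}
    (hA : DifferentiableAt ℝ A y) {A' : E → E →L[ℝ] E →L[ℝ] E →L[ℝ] ℝ}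
    (hd : DifferentiableAt ℝ A' y) (hA' : ∀ z ∈ U, ∀ ξ, A' z ξ = g z ∘L A z ξ) (ξ η : E) :
    cov (actHom (actBil E)) g A' y ξ η = g y ∘L cov (actHom (actEnd E)) g A y ξ η := by
  have h1 : (fun z => A' z η) =ᶠ[𝓝 y] fun z => g z ∘L A z η := by
    filter_upwards [hg.mem_nhds hy] with z hz using hA' z hz η
  rw [cov_hom_eq_cov_eval _ hd, cov_hom_eq_cov_eval _ hA, cov_congr _ h1, hA' y hy,
    cov_bil_apply hg hy (A := fun z => A z η) (hA.clm_apply (differentiableAt_const η)),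
    ContinuousLinearMap.comp_sub]

namespace IsCommutingLog

/-- The Gram determinant is multiplied by `det (exp L) = exp (Tr L)`; its square root produces the
factor `1 / 2`. -/
theorem logDensity_eq (h : IsCommutingLog U g L) (hw0 : ∀ z ∈ U, w z ≠ 0) (hy : y ∈ U) :
    logDensity b (fun z => g z ∘L expEnd (L z)) w y =
      logDensity b g w y + 1 / 2 * traceEnd E (L y) := by
  have hs := h.metric.isScalarProduct y hy
  obtain ⟨b', c, hb'⟩ := hs.exists_eigenbasis (h.selfAdjoint y hy)
  have h1 : (Matrix.of fun i j : Fin n => (g y ∘L expEnd (L y)) (b i) (b j)) =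
      (LinearMap.toMatrix b b (expEnd (L y) : E →ₗ[ℝ] E)).transpose *
        Matrix.of fun i j : Fin n => g y (b i) (b j) := by
    ext i j
    simp only [Matrix.mul_apply, Matrix.of_apply, Matrix.transpose_apply, LinearMap.toMatrix_apply,
      ContinuousLinearMap.comp_apply, ContinuousLinearMap.coe_coe]
    conv_lhs => rw [← b.sum_repr (expEnd (L y) (b i))]
    simp only [map_sum, map_smul, sum_apply, smul_apply, smul_eq_mul]
  have hd := hs.det_pos b
  have h2 := abs_ne_zero.2 (hw0 y hy)
  have h3 : Real.sqrt (Real.exp (LinearMap.trace ℝ E (L y))) =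
      Real.exp (1 / 2 * LinearMap.trace ℝ E (L y)) := by
    rw [Real.sqrt_eq_rpow, ← Real.exp_mul, mul_comm]
  rw [logDensity, h1, Matrix.det_mul, Matrix.det_transpose, LinearMap.det_toMatrix,
    det_expEnd hb', Real.sqrt_mul (Real.exp_pos _).le, h3, mul_div_assoc,
    Real.log_mul (Real.exp_pos _).ne' (div_ne_zero (Real.sqrt_ne_zero'.2 hd) h2), Real.log_exp,
    add_comm]
  rfl

/-- Both the function, by `½ Tr L`, and the connection, by `½ ∇L`, have changed. The coefficient `1
/ 4` comes from the product of the two changes. -/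
theorem hessian_logDensity_eq (h : IsCommutingLog U g L) (hw : ContDiffOn ℝ ∞ w U)
    (hw0 : ∀ z ∈ U, w z ≠ 0) (hy : y ∈ U) (ξ η : E) :
    hessian (fun z => g z ∘L expEnd (L z)) (logDensity b (fun z => g z ∘L expEnd (L z)) w) y ξ η =
      hessian g (logDensity b g w) y ξ η
      + 1 / 2 * traceEnd E (cov (actHom (actEnd E)) g (cov (actEnd E) g L) y ξ η)
      - 1 / 2 * fderiv ℝ (logDensity b g w) y (cov (actEnd E) g L y ξ η)
      - 1 / 4 * traceEnd E (cov (actEnd E) g L y (cov (actEnd E) g L y ξ η)) := by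
  have hf := h.metric.contDiffOn_logDensity b hw hw0
  set f := logDensity b g w
  set f' := logDensity b (fun z => g z ∘L expEnd (L z)) w
  have hfd : ContDiffOn ℝ ∞ (fderiv ℝ f) U := hf.fderiv_of_isOpen h.metric.isOpen (by simp)
  have h1 : ∀ z ∈ U, fderiv ℝ f' z = fderiv ℝ f z + (1 / 2 : ℝ) • (traceEnd E ∘L cov (actEnd E) g L z) := by
    intro z hz
    have h2 : f' =ᶠ[𝓝 z] fun x => f x + (1 / 2 : ℝ) • traceEnd E (L x) := by
      filter_upwards [h.metric.mem_nhds hz] with x hx using h.logDensity_eq b hw0 hx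
    have hfz : DifferentiableAt ℝ f z :=
      (hf.contDiffAt (h.metric.mem_nhds hz)).differentiableAt (by simp)
    have hT : HasFDerivAt (fun x => traceEnd E (L x)) (traceEnd E ∘L fderiv ℝ L z) z :=
      (traceEnd E).hasFDerivAt.comp z (h.differentiableAt hz).hasFDerivAt
    rw [h2.fderiv_eq, (hfz.hasFDerivAt.fun_add (hT.fun_const_smul (1 / 2 : ℝ))).fderiv]
    ext η
    simp [traceEnd_cov]
  have h3 : fderiv ℝ f' =ᶠ[𝓝 y] fun z => fderiv ℝ f z +
      (1 / 2 : ℝ) • (traceEnd E ∘L cov (actEnd E) g L z) := by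
    filter_upwards [h.metric.mem_nhds hy] with z hz using h1 z hz
  have hN := h.differentiableAt_cov hy
  have hfy : DifferentiableAt ℝ (fderiv ℝ f) y :=
    (hfd.contDiffAt (h.metric.mem_nhds hy)).differentiableAt (by simp)
  have hT : DifferentiableAt ℝ (fun z => traceEnd E ∘L cov (actEnd E) g L z) y :=
    (differentiableAt_const _).clm_comp hN
  rw [hessian_apply, hessian_apply, h3.fderiv_eq, fderiv_fun_add hfy (hT.fun_const_smul _),
    fderiv_fun_const_smul hT, h1 y hy, h.christoffel_eq hy, cov_hom_apply, actEnd_apply]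
  have h4 := fderiv_comp_apply (A := fun _ => traceEnd E) (differentiableAt_const _) hN ξ
  simp only [add_apply, smul_apply, h4, map_add, map_sub, map_smul, ContinuousLinearMap.comp_apply,
    traceEnd_mul_comm, fderiv_fun_const, smul_eq_mul]
  simp
  ring

/-- Total symmetry of `∇²L` and self-adjointness move the traced pair of indices to the two
differentiation slots. -/
theorem traceEnd_cov_cov (h : IsCommutingLog U g L) (hy : y ∈ U) (ξ η : E) :
    traceEnd E (cov (actHom (actEnd E)) g (cov (actEnd E) g L) y ξ η) =
      g y (trg b (g y) (cov (actHom (actEnd E)) g (cov (actEnd E) g L) y) ξ) η := by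
  rw [(h.metric.isScalarProduct y hy).traceEnd_eq_sum b, trg, sum_apply, map_sum, sum_apply]
  refine Finset.sum_congr rfl fun i _ => ?_
  rw [h.cov_cov_codazzi hy ξ η, h.cov_cov_comm hy ξ, ← h.cov_cov_selfAdjoint hy,
    h.cov_cov_codazzi hy]

/-- The same exchange of indices, with the commutation of the `∇_ξ L` replacing the symmetry of
second derivatives. -/
theorem traceEnd_cov_apply_cov (h : IsCommutingLog U g L) (hy : y ∈ U) (ξ η : E) :
    traceEnd E (cov (actEnd E) g L y (cov (actEnd E) g L y ξ η)) =
      g y (traceSq b g L y ξ) η := by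
  rw [(h.metric.isScalarProduct y hy).traceEnd_eq_sum b, traceSq, trg, sum_apply, map_sum, sum_apply]
  refine Finset.sum_congr rfl fun i _ => ?_
  have hc := congrArg (fun T : E →L[ℝ] E => T ((g y).inverse (dualForm b i)))
    (h.commute_cov_cov y hy ξ (b i)).eq
  simp only [mul_apply_eq_comp] at hc
  rw [h.codazzi y hy _ (b i), ← h.cov_selfAdjoint hy, ← h.cov_selfAdjoint hy, hc,
    h.codazzi y hy ξ]
  rfl

theorem omegaLaplacian_bil (h : IsCommutingLog U g L) (hy : y ∈ U) :
    omegaLaplacian b w (actBil E) g (fun z => g z ∘L L z) y =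
      g y ∘L omegaLaplacian b w (actEnd E) g L y := by
  have hd : DifferentiableAt ℝ (cov (actBil E) g fun z => g z ∘L L z) y :=
    ((h.metric.contDiffOn_cov _ (h.metric.contDiffOn.clm_comp h.contDiffOn)).contDiffAt
      (h.metric.mem_nhds hy)).differentiableAt (by simp)
  have h1 := cov_hom_bil_apply h.metric hy (h.differentiableAt_cov hy) hd
    fun z hz ξ => cov_bil_apply h.metric hz (h.differentiableAt hz) ξ
  rw [omegaLaplacian, omegaLaplacian, cov_bil_apply h.metric hy (h.differentiableAt hy), trg, trg]
  simp only [h1, ContinuousLinearMap.comp_add, ContinuousLinearMap.comp_neg,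
    ContinuousLinearMap.comp_finsetSum]

/-- The Bakry-Emery-Ricci tensor of the metric `g exp L`. -/
theorem bakryEmery_eq (h : IsCommutingLog U g L) (hw : ContDiffOn ℝ ∞ w U)
    (hw0 : ∀ z ∈ U, w z ≠ 0) (hy : y ∈ U) :
    bakryEmery b w (fun z => g z ∘L expEnd (L z)) y =
      bakryEmery b w g y
      - (1 / 2 : ℝ) • omegaLaplacian b w (actBil E) g (fun z => g z ∘L L z) y
      - (1 / 4 : ℝ) • (g y ∘L traceSq b g L y) := by
  ext ξ η
  have h1 : ricci b (fun z => g z ∘L expEnd (L z)) y = ricci b g y := by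
    simp only [ricci, h.curvature_eq hy]
  have h2 : fderiv ℝ (logDensity b g w) y (cov (actEnd E) g L y ξ η) =
      g y (cov (actEnd E) g L y (gradient g (logDensity b g w) y) ξ) η := by
    rw [h.codazzi y hy _ ξ, h.cov_selfAdjoint hy, gradient,
      (h.metric.isScalarProduct y hy).inverse_apply_left]
  rw [bakryEmery, bakryEmery, h1, h.omegaLaplacian_bil b hy]
  simp only [add_apply, sub_apply, smul_apply, h.hessian_logDensity_eq b hw hw0 hy,
    h.traceEnd_cov_cov b hy, h.traceEnd_cov_apply_cov b hy, h2, omegaLaplacian,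
    ContinuousLinearMap.comp_apply, neg_apply, map_add, map_neg, smul_eq_mul]
  ring

theorem cov_cov_exp (h : IsCommutingLog U g L) (hy : y ∈ U) (r : ℝ) (ξ η : E) :
    cov (actHom (actEnd E)) g (cov (actEnd E) g fun z => expEnd (r • L z)) y ξ η =
      expEnd (r • L y) * ((r * r) • (cov (actEnd E) g L y ξ * cov (actEnd E) g L y η) +
        r • cov (actHom (actEnd E)) g (cov (actEnd E) g L) y ξ η) := by
  have hN := h.differentiableAt_cov hy
  have hH : DifferentiableAt ℝ (fun z => expEnd (r • L z)) y :=
    ((h.contDiffOn_exp r).contDiffAt (h.metric.mem_nhds hy)).differentiableAt (by simp)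
  have hcov : DifferentiableAt ℝ (cov (actEnd E) g fun z => expEnd (r • L z)) y :=
    ((h.metric.contDiffOn_cov _ (h.contDiffOn_exp r)).contDiffAt
      (h.metric.mem_nhds hy)).differentiableAt (by simp)
  have h1 : (fun z => cov (actEnd E) g (fun z => expEnd (r • L z)) z η) =ᶠ[𝓝 y]
      fun z => r • (expEnd (r • L z) * cov (actEnd E) g L z η) := by
    filter_upwards [h.metric.mem_nhds hy] with z hz using h.cov_exp hz r η
  have hNη : DifferentiableAt ℝ (fun z => cov (actEnd E) g L z η) y :=
    hN.clm_apply (differentiableAt_const η)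
  rw [cov_hom_end_apply hcov, cov_hom_end_apply hN, cov_congr _ h1,
    cov_smul (A := fun z => expEnd (r • L z) * cov (actEnd E) g L z η) (hH.mul hNη),
    cov_mul hH hNη, h.cov_exp hy, h.cov_exp hy]
  simp only [mul_add, mul_sub, smul_sub, smul_add, mul_smul_comm, smul_mul_assoc, mul_assoc,
    smul_smul]
  module

/-- For `r = -1/2` the coefficients `r` and `r²` of `cov_cov_exp` are those of `bakryEmery_eq`, so
the quadratic gradient term is absorbed into a single Laplacian. This singles out the power `(g⁻¹
g₀)^{1/2}`. -/
theorem omegaLaplacian_exp (h : IsCommutingLog U g L) (hy : y ∈ U) :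
    omegaLaplacian b w (actEnd E) g (fun z => expEnd ((-(1 / 2) : ℝ) • L z)) y =
      expEnd ((-(1 / 2) : ℝ) • L y) * (- (1 / 2 : ℝ) • omegaLaplacian b w (actEnd E) g L y
        - (1 / 4 : ℝ) • traceSq b g L y) := by
  rw [omegaLaplacian_end_apply, omegaLaplacian_end_apply, h.cov_exp hy]
  simp only [h.cov_cov_exp hy, traceSq, trg]
  simp only [← Finset.mul_sum, Finset.sum_add_distrib, ← Finset.smul_sum, ← mul_smul_comm,
    ← mul_neg, ← mul_add]
  congr 1
  simp only [ContinuousLinearMap.bilinearComp_apply, ContinuousLinearMap.compL_apply,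
    ← ContinuousLinearMap.mul_def, mul_smul_comm, ← Finset.smul_sum]
  module

/-- The endomorphism associated to the Bakry-Emery-Ricci tensor of the metric `g exp L`. -/
theorem sharp_bakryEmery_eq (h : IsCommutingLog U g L) (hw : ContDiffOn ℝ ∞ w U)
    (hw0 : ∀ z ∈ U, w z ≠ 0) (hy : y ∈ U) :
    sharp (g y ∘L expEnd (L y)) (bakryEmery b w (fun z => g z ∘L expEnd (L z)) y) =
      expEnd ((-(1 / 2) : ℝ) • L y) *
        omegaLaplacian b w (actEnd E) g (fun z => expEnd ((-(1 / 2) : ℝ) • L z)) y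
      + expEnd ((-(1 / 2) : ℝ) • L y) ^ 2 * sharp (g y) (bakryEmery b w g y) := by
  -- With `H = exp (-L/2)` this is `exp L · H² = 1`: the metric `g exp L` undoes the factor `H²` and
  -- gives back `g`.
  have h1 : expEnd (L y) * (expEnd ((-(1 / 2) : ℝ) • L y) * expEnd ((-(1 / 2) : ℝ) • L y)) = 1 := by
    have hc := Commute.refl (L y)
    rw [← expEnd_add (Commute.refl _), ← expEnd_add ((hc.smul_right _).add_right (hc.smul_right _)),
      ← expEnd_zero]
    congr 1
    module
  -- The right-hand side becomes `sharp` of a bilinear form, leaving an identity of forms to compare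
  -- with `bakryEmery_eq`.
  rw [← (h.isMetricOn.isScalarProduct y hy).sharp_comp
    (expEnd ((-(1 / 2) : ℝ) • L y) * omegaLaplacian b w (actEnd E) g
      (fun z => expEnd ((-(1 / 2) : ℝ) • L z)) y
      + expEnd ((-(1 / 2) : ℝ) • L y) ^ 2 * sharp (g y) (bakryEmery b w g y))]
  congr 1
  rw [ContinuousLinearMap.comp_assoc, ← ContinuousLinearMap.mul_def (expEnd (L y)), mul_add, pow_two,
    h.omegaLaplacian_exp b hy, ← mul_assoc _ _ (sharp _ _), h1, one_mul, ← mul_assoc, ← mul_assoc,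
    mul_assoc (expEnd _), h1, one_mul, ContinuousLinearMap.comp_add,
    (h.metric.isScalarProduct y hy).comp_sharp, h.bakryEmery_eq b hw hw0 hy,
    h.omegaLaplacian_bil b hy]
  ext
  simp
  ring

end IsCommutingLog

end Coordinates

theorem funCalc_selfAdjoint {V : Type*} [AddCommGroup V] [Module ℝ V] [TopologicalSpace V]
    [IsTopologicalAddGroup V] [ContinuousSMul ℝ V] {g : V →L[ℝ] V →L[ℝ] ℝ} {B : V →L[ℝ] V}
    (h : ∀ x y, g (B x) y = g x (B y)) (φ : ℝ → ℝ) (x y : V) :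
    g (funCalc φ B x) y = g x (funCalc φ B y) := by
  suffices key : ∀ (p : Polynomial ℝ) (x y : V),
      g (Polynomial.aeval B p x) y = g x (Polynomial.aeval B p y) from key _ x y
  intro p
  induction p using Polynomial.induction_on' with
  | add p q hp hq => intro x y; simp [hp, hq]
  | monomial k a =>
    have hk : ∀ (k : ℕ) (x y : V), g ((B ^ k) x) y = g x ((B ^ k) y) := by
      intro k
      induction k with
      | zero => simp
      | succ k ih =>
        intro x y
        rw [pow_succ', mul_apply_eq_comp, h, ih, ← mul_apply_eq_comp, ← pow_succ, pow_succ']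
    intro x y
    simp only [Polynomial.aeval_monomial, Algebra.algebraMap_eq_smul_one, smul_mul_assoc, one_mul,
      smul_apply, map_smul, hk]

/-! ### From the conditions on `K` to a commuting logarithm. -/

section Coordinates

variable {E : Type} [NormedAddCommGroup E] [NormedSpace ℝ E] [FiniteDimensional ℝ E]
  {U : Set E} {g : E → E →L[ℝ] E →L[ℝ] ℝ} {K B : E → E →L[ℝ] E} {y : E}

variable (U K) in
/-- The endomorphism `K` has simple real spectrum over a dense subset of `U`. -/
def IsGenericallySimple : Prop :=
  ∀ y ∈ U, ∃ᶠ z in 𝓝 y, z ∈ U ∧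
    {c : ℝ | Module.End.HasEigenvalue (K z : E →ₗ[ℝ] E) c}.ncard = Module.finrank ℝ E

/-- The commutator is continuous. If it were nonzero at `y` it would be nonzero nearby, in
particular at a point where `K` has simple spectrum and a commutative commutant. -/
theorem IsGenericallySimple.commute (hU : IsOpen U) (hK : IsGenericallySimple U K)
    {M N : E → E →L[ℝ] E} (hM : ContinuousOn M U) (hN : ContinuousOn N U)
    (hKM : ∀ z ∈ U, Commute (K z) (M z)) (hKN : ∀ z ∈ U, Commute (K z) (N z)) (hy : y ∈ U) :
    Commute (M y) (N y) := by
  have hc : ContinuousAt (fun z => M z * N z - N z * M z) y := by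
    have h1 := hM.continuousAt (hU.mem_nhds hy)
    have h2 := hN.continuousAt (hU.mem_nhds hy)
    exact (h1.mul h2).sub (h2.mul h1)
  by_contra hne
  have h1 : ∀ᶠ z in 𝓝 y, M z * N z - N z * M z ≠ 0 := hc.eventually_ne (sub_ne_zero.2 hne)
  obtain ⟨z, ⟨hzU, hz⟩, hz'⟩ := ((hK y hy).and_eventually h1).exists
  exact hz' (sub_eq_zero.2 (commute_of_distinct_eigenvalues hz (hKM z hzU) (hKN z hzU)))

variable (U g K B) in
/-- The coordinate expression of the condition `g B ∈ Σ_K (g)`, for the derivatives of `K` of order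
at most one and for the curvature. -/
structure IsSigmaOn : Prop where
  metric : IsMetricOn U g
  contDiffOn_K : ContDiffOn ℝ ∞ K U
  simple : IsGenericallySimple U K
  contDiffOn : ContDiffOn ℝ ∞ B U
  isScalarProduct : ∀ z ∈ U, IsScalarProduct (g z ∘L B z)
  codazzi : ∀ z ∈ U, ∀ ξ η, cov (actEnd E) g B z ξ η = cov (actEnd E) g B z η ξ
  commute_K : ∀ z ∈ U, Commute (K z) (B z)
  commute_cov_K : ∀ z ∈ U, ∀ ξ, Commute (cov (actEnd E) g K z ξ) (B z)
  commute_curvature : ∀ z ∈ U, ∀ ξ η, Commute (curvature g z ξ η) (B z)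

namespace IsSigmaOn

theorem isPositive (h : IsSigmaOn U g K B) (hy : y ∈ U) : IsPositive (B y) :=
  (h.metric.isScalarProduct y hy).isPositive (h.isScalarProduct y hy)

theorem selfAdjoint (h : IsSigmaOn U g K B) (hy : y ∈ U) (η ζ : E) :
    g y (B y η) ζ = g y η (B y ζ) :=
  ((h.isScalarProduct y hy).symm η ζ).trans ((h.metric.isScalarProduct y hy).symm _ _)

theorem expEnd_log (h : IsSigmaOn U g K B) (hy : y ∈ U) :
    expEnd (funCalc Real.log (B y)) = B y :=
  (h.isPositive hy).expEnd_log

theorem contDiffOn_log (h : IsSigmaOn U g K B) :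
    ContDiffOn ℝ ∞ (fun z => funCalc Real.log (B z)) U := by
  have h1 : ContDiffOn ℝ ∞ (fun z => logInt (B z)) U := fun z hz =>
    (contDiffAt_logInt (h.isPositive hz)).comp_contDiffWithinAt z (h.contDiffOn z hz)
  exact h1.congr fun z hz => funCalc_log (h.isPositive hz)

/-- Differentiate `[K, log B] = 0`: the term `[∇_ξ K, log B]` vanishes, so the other term does. -/
theorem commute_K_cov_log (h : IsSigmaOn U g K B) (hy : y ∈ U) (ξ : E) :
    Commute (K y) (cov (actEnd E) g (fun z => funCalc Real.log (B z)) y ξ) := by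
  have hL := (h.contDiffOn_log.contDiffAt (h.metric.mem_nhds hy)).differentiableAt (by simp)
  have hK := (h.contDiffOn_K.contDiffAt (h.metric.mem_nhds hy)).differentiableAt (by simp)
  have h1 : (fun z => K z * funCalc Real.log (B z)) =ᶠ[𝓝 y] fun z => funCalc Real.log (B z) * K z := by
    filter_upwards [h.metric.mem_nhds hy] with z hz using commute_funCalc (h.commute_K z hz) _
  have h2 := congrArg (fun T : E →L[ℝ] E →L[ℝ] E => T ξ) (cov_congr (g := g) (actEnd E) h1)
  simp only [cov_mul hK hL, cov_mul hL hK] at h2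
  rw [(commute_funCalc (h.commute_cov_K y hy ξ) Real.log).eq, add_comm] at h2
  exact add_right_cancel h2

theorem commute_log (h : IsSigmaOn U g K B) (hy : y ∈ U) :
    Commute (K y) (funCalc Real.log (B y)) := commute_funCalc (h.commute_K y hy) _

theorem isCommutingLog (h : IsSigmaOn U g K B) :
    IsCommutingLog U g fun z => funCalc Real.log (B z) := by
  have hN := h.metric.contDiffOn_cov (actEnd E) h.contDiffOn_log
  have hNξ : ∀ ξ, ContinuousOn
      (fun z => cov (actEnd E) g (fun z => funCalc Real.log (B z)) z ξ) U :=
    fun ξ => hN.continuousOn.clm_apply continuousOn_const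
  have hcov : ∀ z ∈ U, ∀ ξ, Commute (funCalc Real.log (B z))
      (cov (actEnd E) g (fun z => funCalc Real.log (B z)) z ξ) := fun z hz ξ =>
    h.simple.commute h.metric.isOpen h.contDiffOn_log.continuousOn (hNξ ξ)
      (fun z hz => h.commute_log hz) (fun z hz => h.commute_K_cov_log hz ξ) hz
  refine ⟨h.metric, h.contDiffOn_log, fun z hz => funCalc_selfAdjoint (fun η ζ => h.selfAdjoint hz η ζ) _,
    fun z hz ξ η => ?_, fun z hz ξ η => commute_funCalc (h.commute_curvature z hz ξ η) _, hcov,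
    fun z hz ξ η => h.simple.commute h.metric.isOpen (hNξ ξ) (hNξ η)
      (fun z hz => h.commute_K_cov_log hz ξ) (fun z hz => h.commute_K_cov_log hz η) hz⟩
  have hL := (h.contDiffOn_log.contDiffAt (h.metric.mem_nhds hz)).differentiableAt (by simp)
  have h1 : (fun z => expEnd (funCalc Real.log (B z))) =ᶠ[𝓝 z] B := by
    filter_upwards [h.metric.mem_nhds hz] with x hx using h.expEnd_log hx
  have h2 : ∀ ξ, cov (actEnd E) g B z ξ =
      B z * cov (actEnd E) g (fun z => funCalc Real.log (B z)) z ξ := by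
    intro ξ
    rw [← cov_congr _ h1, cov_expEnd hL (hcov z hz ξ), h.expEnd_log hz]
  have h3 := h.codazzi z hz ξ η
  rw [h2, h2, mul_apply_eq_comp, mul_apply_eq_comp] at h3
  -- The Codazzi equation of `B` reads `B (∇_ξ L η) = B (∇_η L ξ)`; nondegeneracy of `g B` cancels
  -- `B`.
  refine eq_of_apply_eq (h.isScalarProduct z hz) (g := fun z => g z ∘L B z) (y := z) fun ζ => ?_
  simp only [ContinuousLinearMap.comp_apply, h3]

end IsSigmaOn

end Coordinates

/-! ### Charts and smoothness of tensor fields on the manifold. -/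

section Manifold

variable {n : ℕ} {X : Type*} [TopologicalSpace X] [ChartedSpace (Rn n) X]

instance (x : X) : T2Space (TangentSpace (𝓡 n) x) := inferInstanceAs (T2Space (Rn n))

instance (x : X) : FiniteDimensional ℝ (TangentSpace (𝓡 n) x) :=
  inferInstanceAs (FiniteDimensional ℝ (Rn n))

theorem bilChart_apply (e : OpenPartialHomeomorph X (Rn n)) (v : BilField n X) (y ξ η : Rn n) :
    bilChart e v y ξ η = v (e.symm y) (dchart e y ξ) (dchart e y η) := rfl

variable [IsManifold (𝓡 n) ∞ X] {e : OpenPartialHomeomorph X (Rn n)} {y : Rn n}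

theorem mdifferentiable_of_mem_charts (he : e ∈ charts n X) :
    e.MDifferentiable (𝓡 n) 𝓘(ℝ, Rn n) :=
  ⟨(contMDiffOn_of_mem_maximalAtlas he).mdifferentiableOn (by simp),
    (contMDiffOn_symm_of_mem_maximalAtlas he).mdifferentiableOn (by simp)⟩

/-- The differential of the inverse of a chart as an isomorphism. -/
def dchartEquiv (he : e ∈ charts n X) (hy : y ∈ e.target) :
    Rn n ≃L[ℝ] TangentSpace (𝓡 n) (e.symm y) :=
  ContinuousLinearEquiv.equivOfInverse (dchart e y) (mfderiv (𝓡 n) 𝓘(ℝ, Rn n) e (e.symm y))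
    (fun ξ => congrArg (fun T : Rn n →L[ℝ] Rn n => T ξ)
      ((mdifferentiable_of_mem_charts he).comp_symm_deriv hy))
    (fun ξ => by
      have h := (mdifferentiable_of_mem_charts he).symm_comp_deriv (e.map_target hy)
      have h2 := congrArg (fun T : TangentSpace (𝓡 n) (e.symm y) →L[ℝ] TangentSpace (𝓡 n) (e.symm y) => T ξ) h
      rw [e.right_inv hy] at h2
      exact h2)

theorem coe_dchartEquiv (he : e ∈ charts n X) (hy : y ∈ e.target) :
    (dchartEquiv he hy : Rn n →L[ℝ] TangentSpace (𝓡 n) (e.symm y)) = dchart e y := rfl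

theorem dchart_inverse (he : e ∈ charts n X) (hy : y ∈ e.target) :
    (dchart e y).inverse = mfderiv (𝓡 n) 𝓘(ℝ, Rn n) e (e.symm y) := by
  rw [← coe_dchartEquiv he hy, ContinuousLinearMap.inverse_equiv]
  rfl

theorem endChart_eq (he : e ∈ charts n X) (hy : y ∈ e.target) (A : EndField n X) :
    endChart e A y = ((dchartEquiv he hy).symm : _ →L[ℝ] Rn n) ∘L A (e.symm y) ∘L dchartEquiv he hy := by
  rw [endChart, ← coe_dchartEquiv he hy, ContinuousLinearMap.inverse_equiv]

theorem dchart_endChart (he : e ∈ charts n X) (hy : y ∈ e.target) (A : EndField n X) (ξ : Rn n) :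
    dchart e y (endChart e A y ξ) = A (e.symm y) (dchart e y ξ) := by
  rw [endChart_eq he hy, ← coe_dchartEquiv he hy]
  simp

/-- A constant field on the chart domain pushed forward by the tangent map; smooth sections are
evaluated on such fields to get smooth coordinate expressions. -/
theorem contMDiffOn_dchart (he : e ∈ charts n X) (ξ : Rn n) :
    ContMDiffOn 𝓘(ℝ, Rn n) (𝓡 n).tangent ∞
      (fun y => (⟨e.symm y, dchart e y ξ⟩ : TangentBundle (𝓡 n) X)) e.target := by
  have h1 := (contMDiffOn_symm_of_mem_maximalAtlas he).contMDiffOn_tangentMapWithin (m := ∞)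
    (by simp) e.open_target.uniqueMDiffOn
  have h2 : ContMDiffOn 𝓘(ℝ, Rn n) 𝓘(ℝ, Rn n).tangent ∞
      (fun y => (⟨y, ξ⟩ : TangentBundle 𝓘(ℝ, Rn n) (Rn n))) e.target :=
    contMDiffOn_vectorSpace_iff_contDiffOn.2 contDiffOn_const
  refine (h1.comp h2 fun y hy => hy).congr fun y hy => ?_
  simp only [Function.comp_apply, tangentMapWithin, dchart]
  rw [mfderivWithin_of_isOpen e.open_target hy]
  rfl

theorem contDiffOn_bilChart (he : e ∈ charts n X) (v : BilSection n X) :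
    ContDiffOn ℝ ∞ (bilChart e v) e.target := by
  rw [contDiffOn_clm_apply]
  intro ξ
  rw [contDiffOn_clm_apply]
  intro η
  have hv := v.contMDiff.comp_contMDiffOn (contMDiffOn_symm_of_mem_maximalAtlas he)
  have h := ContMDiffOn.clm_bundle_apply₂ (E₃ := fun _ : X => ℝ) (F₃ := ℝ) hv (contMDiffOn_dchart he ξ) (contMDiffOn_dchart he η)
  intro y hy
  have h1 := (contMDiffWithinAt_totalSpace.1 (h y hy)).2
  exact h1.contDiffWithinAt

theorem contDiffOn_endChart (he : e ∈ charts n X) (A : EndSection n X) :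
    ContDiffOn ℝ ∞ (endChart e A) e.target := by
  rw [contDiffOn_clm_apply]
  intro ξ
  have hA := A.contMDiff.comp_contMDiffOn (contMDiffOn_symm_of_mem_maximalAtlas he)
  have h := ContMDiffOn.clm_bundle_apply hA (contMDiffOn_dchart he ξ)
  have h1 := (contMDiffOn_of_mem_maximalAtlas he).contMDiffOn_tangentMapWithin (m := ∞)
    (by simp) e.open_source.uniqueMDiffOn
  have h2 := h1.comp h fun y hy => e.map_target hy
  have h3 := (contMDiff_snd_tangentBundle_modelSpace (Rn n) 𝓘(ℝ, Rn n) (n := ∞)).comp_contMDiffOn h2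
  refine h3.contDiffOn.congr fun y hy => ?_
  have h4 := mfderivWithin_of_isOpen (I := 𝓡 n) (I' := 𝓘(ℝ, Rn n)) (f := e) e.open_source
    (e.map_target hy)
  rw [endChart, dchart_inverse he hy]
  exact congrArg (fun T : TangentSpace (𝓡 n) (e.symm y) →L[ℝ] Rn n =>
    T (A (e.symm y) (dchart e y ξ))) h4.symm

/-- Identifies the bundle coordinates, in which smoothness of a section is defined, with those of
`bilChart`. -/
theorem symm_trivializationAt {x₀ x : X} (hx : x ∈ (chartAt (Rn n) x₀).source) (ξ : Rn n) :
    (trivializationAt (Rn n) (TangentSpace (𝓡 n)) x₀).symm x ξ =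
      dchart (chartAt (Rn n) x₀) (chartAt (Rn n) x₀ x) ξ := by
  have h := TangentBundle.symmL_trivializationAt (I := 𝓡 n) hx
  rw [ModelWithCorners.range_eq_univ, mfderivWithin_univ] at h
  have h1 := congrArg (fun T : Rn n →L[ℝ] TangentSpace (𝓡 n) x => T ξ) h
  rw [Trivialization.symmL_apply _ hx] at h1
  exact h1

/-- Converse of `contDiffOn_bilChart`, needed to build new metrics from powers of `g₀⁻¹ g`. -/
theorem contMDiff_of_bilChart {v : BilField n X}
    (h : ∀ e ∈ charts n X, ContDiffOn ℝ ∞ (bilChart e v) e.target) :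
    ContMDiff (𝓡 n) ((𝓡 n).prod 𝓘(ℝ, Bil n)) ∞ (fun x => TotalSpace.mk' (Bil n)
      (E := fun x : X => TangentSpace (𝓡 n) x →L[ℝ] TangentSpace (𝓡 n) x →L[ℝ] ℝ) x (v x)) := by
  intro x₀
  rw [contMDiffAt_hom_bundle]
  refine ⟨contMDiffAt_id, ?_⟩
  have he : chartAt (Rn n) x₀ ∈ charts n X := IsManifold.chart_mem_maximalAtlas x₀
  have hx₀ := mem_chart_source (Rn n) x₀
  have h1 := (h _ he).contDiffAt ((chartAt (Rn n) x₀).open_target.mem_nhds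
    ((chartAt (Rn n) x₀).map_source hx₀))
  have h2 := h1.contMDiffAt.comp x₀ (contMDiffAt_of_mem_maximalAtlas he hx₀)
  refine h2.congr_of_eventuallyEq ?_
  filter_upwards [(chartAt (Rn n) x₀).open_source.mem_nhds hx₀] with x hx
  ext ξ η
  -- The point `e.symm (e x)` equals `x` only propositionally, while all fibres are definitionally
  -- `ℝⁿ`; values of `v` are therefore transported as forms on `ℝⁿ`.
  have key : ∀ x', x' = x → ∀ a b : Rn n, (v x : Bil n) a b = (v x' : Bil n) a b := by
    rintro _ rfl a b
    rfl
  have h3 := inCoordinates_apply_eq₂ (F₁ := Rn n) (F₂ := Rn n) (F₃ := ℝ)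
    (E₁ := fun x : X => TangentSpace (𝓡 n) x) (E₂ := fun x : X => TangentSpace (𝓡 n) x)
    (E₃ := fun _ : X => ℝ) (ϕ := v x) (v := ξ) (w := η) hx hx (mem_univ x)
  rw [symm_trivializationAt hx, symm_trivializationAt hx] at h3
  refine Eq.trans ?_ (Eq.trans h3 ?_)
  · rfl
  · have h4 := congrArg (fun T : ℝ →ₗ[ℝ] ℝ => T (v x (dchart (chartAt (Rn n) x₀) (chartAt (Rn n) x₀ x) ξ)
      (dchart (chartAt (Rn n) x₀) (chartAt (Rn n) x₀ x) η)))
      (Bundle.Trivial.linearMapAt_trivialization ℝ X ℝ x)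
    refine Eq.trans h4 ?_
    exact key _ ((chartAt (Rn n) x₀).left_inv hx) _ _

end Manifold

/-! ### Real powers of positive endomorphisms, without a norm. -/

section LinearAlgebra

variable {V : Type*} [AddCommGroup V] [Module ℝ V] [TopologicalSpace V]
  [IsTopologicalAddGroup V] [ContinuousSMul ℝ V] [FiniteDimensional ℝ V]

/-- Places `H = (g⁻¹ g₀)^{1/2}` among the powers of `g₀⁻¹ g`, since `√(c⁻¹) = exp (-½ log c)`. -/
theorem IsPositive.funCalc_sqrt_of_mul_eq_one {B C : V →L[ℝ] V} (hB : IsPositive B) (hC : C * B = 1) :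
    funCalc Real.sqrt C = funCalc (fun c => Real.exp (-(1 / 2) * Real.log c)) B := by
  obtain ⟨b, c, hc, h⟩ := hB
  have hC' : IsEigenbasis b (fun i => (c i)⁻¹) C := by
    intro i
    have h1 : C (B (b i)) = b i := congrArg (fun T : V →L[ℝ] V => T (b i)) hC
    rw [h i, map_smul] at h1
    have h2 := congrArg (fun v => (c i)⁻¹ • v) h1
    simpa [smul_smul, (hc i).ne'] using h2
  refine ((hC'.funCalc Real.sqrt).ext fun i => ?_)
  rw [(h.funCalc _) i]
  congr 1
  simp only
  rw [Real.sqrt_eq_rpow, Real.rpow_def_of_pos (inv_pos.2 (hc i)), Real.log_inv]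
  ring_nf

theorem IsPositive.funCalc_exp_mul_log_mul {B : V →L[ℝ] V} (hB : IsPositive B) (r s : ℝ) :
    funCalc (fun c => Real.exp (r * Real.log c)) B * funCalc (fun c => Real.exp (s * Real.log c)) B =
      funCalc (fun c => Real.exp ((r + s) * Real.log c)) B := by
  obtain ⟨b, c, hc, h⟩ := hB
  refine IsEigenbasis.ext (b := b) (fun i => ?_) (h.funCalc _)
  rw [mul_apply_eq_comp, (h.funCalc _) i, map_smul, (h.funCalc _) i, smul_smul, ← Real.exp_add]
  congr 2
  ring

theorem IsPositive.funCalc_exp_zero {B : V →L[ℝ] V} (hB : IsPositive B) :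
    funCalc (fun c => Real.exp (0 * Real.log c)) B = 1 := by
  obtain ⟨b, c, hc, h⟩ := hB
  exact (h.funCalc _).ext fun i => by simp

theorem IsPositive.funCalc_exp_one {B : V →L[ℝ] V} (hB : IsPositive B) :
    funCalc (fun c => Real.exp (1 * Real.log c)) B = B := by
  obtain ⟨b, c, hc, h⟩ := hB
  exact (h.funCalc _).ext fun i => by simp [Real.exp_log (hc i), h i]

theorem IsPositive.funCalc_comp {B : V →L[ℝ] V} (hB : IsPositive B) (φ ψ : ℝ → ℝ) :
    funCalc φ (funCalc ψ B) = funCalc (fun c => φ (ψ c)) B := by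
  obtain ⟨b, c, hc, h⟩ := hB
  exact ((h.funCalc ψ).funCalc φ).ext (h.funCalc _)

variable [T2Space V]

theorem IsScalarProduct.sharp_mul_sharp {g h : V →L[ℝ] V →L[ℝ] ℝ} (hg : IsScalarProduct g)
    (hh : IsScalarProduct h) : sharp g h * sharp h g = 1 := by
  ext x
  change g.inverse (h (sharp h g x)) = x
  rw [hh.apply_sharp, hg.inverse_apply_right]

theorem IsScalarProduct.isPositive_sharp {g h : V →L[ℝ] V →L[ℝ] ℝ} (hg : IsScalarProduct g)
    (hh : IsScalarProduct h) : IsPositive (sharp g h) :=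
  hg.isPositive (by rwa [hg.comp_sharp])

theorem IsScalarProduct.sharp_selfAdjoint {g h : V →L[ℝ] V →L[ℝ] ℝ} (hg : IsScalarProduct g)
    (hh : ∀ x y, h x y = h y x) (x y : V) : g (sharp g h x) y = g x (sharp g h y) := by
  rw [hg.apply_sharp, hg.symm x, hg.apply_sharp, hh]

/-- The half-power argument of `IsScalarProduct.comp_expEnd`, carried out with `funCalc`. -/
theorem IsScalarProduct.comp_funCalc_exp {g h : V →L[ℝ] V →L[ℝ] ℝ} (hg : IsScalarProduct g)
    (hh : IsScalarProduct h) (r : ℝ) :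
    IsScalarProduct (g ∘L funCalc (fun c => Real.exp (r * Real.log c)) (sharp g h)) where
  symm x y := (funCalc_selfAdjoint (hg.sharp_selfAdjoint hh.symm) _ x y).trans (hg.symm _ _)
  pos x hx := by
    have hB := hg.isPositive_sharp hh
    have h1 := hB.funCalc_exp_mul_log_mul (r / 2) (r / 2)
    have h2 := hB.funCalc_exp_mul_log_mul (-(r / 2)) (r / 2)
    rw [add_halves] at h1
    rw [neg_add_cancel, hB.funCalc_exp_zero] at h2
    rw [ContinuousLinearMap.comp_apply, ← h1, mul_apply_eq_comp,
      funCalc_selfAdjoint (hg.sharp_selfAdjoint hh.symm)]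
    refine hg.pos _ fun h0 => hx ?_
    have := congrArg (fun T : V →L[ℝ] V => T x) h2
    simp only [mul_apply_eq_comp, h0, map_zero, one_apply_eq_self] at this
    exact this.symm

theorem HasEigenvalue.of_conj {V W : Type*} [AddCommGroup V] [Module ℝ V] [AddCommGroup W]
    [Module ℝ W] {A : V →ₗ[ℝ] V} {B : W →ₗ[ℝ] W} {c : ℝ} (P : V ≃ₗ[ℝ] W)
    (hP : ∀ x, P (A x) = B (P x)) (h : Module.End.HasEigenvalue A c) :
    Module.End.HasEigenvalue B c := by
  obtain ⟨x, hx⟩ := h.exists_hasEigenvector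
  refine Module.End.hasEigenvalue_of_hasEigenvector (x := P x)
    ⟨Module.End.mem_eigenspace_iff.2 ?_, fun h0 => hx.2 (by simpa using h0)⟩
  rw [← hP, hx.apply_eq_smul, map_smul]

end LinearAlgebra

/-! ### Locality: dependence on germs only. -/

section Coordinates

variable {E : Type} [NormedAddCommGroup E] [NormedSpace ℝ E]
  {F : Type} [NormedAddCommGroup F] [NormedSpace ℝ F] {n : ℕ} (b : Module.Basis (Fin n) ℝ E)
  {g g' : E → E →L[ℝ] E →L[ℝ] ℝ} {w : E → ℝ} {y : E}

theorem christoffel_congr (h : g =ᶠ[𝓝 y] g') : christoffel g y = christoffel g' y := by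
  simp only [christoffel, h.fderiv_eq, h.eq_of_nhds]

theorem christoffel_eventuallyEq (h : g =ᶠ[𝓝 y] g') : christoffel g =ᶠ[𝓝 y] christoffel g' :=
  h.eventuallyEq_nhds.mono fun _ hz => christoffel_congr hz

theorem curvature_congr (h : g =ᶠ[𝓝 y] g') : curvature g y = curvature g' y := by
  simp only [curvature, (christoffel_eventuallyEq h).fderiv_eq, christoffel_congr h]

theorem cov_eventuallyEq (ρ : TensorAction E F) {A B : E → F} (h : A =ᶠ[𝓝 y] B) :
    cov ρ g A =ᶠ[𝓝 y] cov ρ g B :=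
  h.eventuallyEq_nhds.mono fun _ hz => by simp [cov, hz.fderiv_eq, hz.eq_of_nhds]

variable [FiniteDimensional ℝ E]

theorem bakryEmery_congr (h : g =ᶠ[𝓝 y] g') : bakryEmery b w g y = bakryEmery b w g' y := by
  have h1 : logDensity b g w =ᶠ[𝓝 y] logDensity b g' w :=
    h.mono fun z hz => by simp only [logDensity, hz]
  ext ξ η
  simp only [bakryEmery, ricci, curvature_congr h, add_apply, hessian_apply, christoffel_congr h,
    h1.fderiv_eq, h1.fderiv.fderiv_eq]

theorem omegaLaplacian_congr (ρ : TensorAction E F) {A B : E → F} (h : A =ᶠ[𝓝 y] B) :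
    omegaLaplacian b w ρ g A y = omegaLaplacian b w ρ g B y := by
  simp only [omegaLaplacian, cov_congr _ (cov_eventuallyEq (g := g) ρ h), cov_congr ρ h]

end Coordinates

/-! ### The formulas and the bijection over the manifold. -/

section Manifold

variable {n : ℕ} {X : Type*} [TopologicalSpace X] [ChartedSpace (Rn n) X]
  [IsManifold (𝓡 n) ∞ X] {e : OpenPartialHomeomorph X (Rn n)} {y : Rn n}
  {K : EndSection n X} {g₀ g h : RiemMetric n X}

theorem RiemMetric.isScalarProduct (g : RiemMetric n X) (x : X) : IsScalarProduct (g.inner x) :=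
  ⟨g.symm x, g.pos x⟩

theorem RiemMetric.isScalarProduct_bilChart (he : e ∈ charts n X) (hy : y ∈ e.target)
    (g : RiemMetric n X) : IsScalarProduct (bilChart e g.inner y) where
  symm ξ η := g.symm _ _ _
  pos ξ hξ := by
    refine g.pos _ _ fun h0 => hξ ?_
    rw [← coe_dchartEquiv he hy] at h0
    simpa using h0

theorem RiemMetric.isMetricOn (he : e ∈ charts n X) (g : RiemMetric n X) :
    IsMetricOn e.target (bilChart e g.inner) :=
  ⟨e.open_target, contDiffOn_bilChart he g.toSection,
    fun _ hy => g.isScalarProduct_bilChart he hy⟩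

theorem endChart_sharp (he : e ∈ charts n X) (hy : y ∈ e.target) (g : RiemMetric n X)
    (v : BilField n X) :
    endChart e (fun x => sharp (g.inner x) (v x)) y =
      sharp (bilChart e g.inner y) (bilChart e v y) := by
  rw [← (g.isScalarProduct_bilChart he hy).sharp_comp
    (endChart e (fun x => sharp (g.inner x) (v x)) y)]
  congr 1
  ext ξ η
  rw [ContinuousLinearMap.comp_apply, bilChart_apply, dchart_endChart he hy,
    (g.isScalarProduct _).apply_sharp]
  rfl

theorem bilChart_comp_endChart_sharp (he : e ∈ charts n X) (hy : y ∈ e.target) (g : RiemMetric n X)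
    (v : BilField n X) :
    bilChart e g.inner y ∘L endChart e (fun x => sharp (g.inner x) (v x)) y = bilChart e v y := by
  rw [endChart_sharp he hy, (g.isScalarProduct_bilChart he hy).comp_sharp]

theorem IsEigenbasis.endChart (he : e ∈ charts n X) (hy : y ∈ e.target) {A : EndField n X}
    {ι : Type*} {b : Module.Basis ι ℝ (TangentSpace (𝓡 n) (e.symm y))} {c : ι → ℝ}
    (h : IsEigenbasis b c (A (e.symm y))) :
    IsEigenbasis (b.map (dchartEquiv he hy).symm.toLinearEquiv) c (endChart e A y) := by
  intro i
  rw [endChart_eq he hy]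
  simp [h i]

theorem endChart_funCalc (he : e ∈ charts n X) (hy : y ∈ e.target) {A : EndField n X}
    (hA : IsPositive (A (e.symm y))) (φ : ℝ → ℝ) :
    endChart e (fun x => funCalc φ (A x)) y = funCalc φ (endChart e A y) := by
  obtain ⟨b, c, -, h⟩ := hA
  exact IsEigenbasis.ext (IsEigenbasis.endChart he hy (A := fun x => funCalc φ (A x)) (h.funCalc φ))
    ((h.endChart he hy).funCalc φ)

/-- A nonempty open set has positive Lebesgue measure, so it is not contained in the null
exceptional set. Eigenvalues are unchanged by conjugation with the differential of the chart. -/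
theorem isGenericallySimple (he : e ∈ charts n X) (hK : HasDistinctEigenvalues K) :
    IsGenericallySimple e.target (endChart e K) := by
  intro y hy
  rw [Filter.frequently_iff]
  intro V hV
  obtain ⟨W, hWV, hW, hyW⟩ := mem_nhds_iff.1 (Filter.inter_mem hV (e.open_target.mem_nhds hy))
  by_contra! hno
  refine hW.measure_ne_zero MeasureTheory.volume ⟨y, hyW⟩
    (MeasureTheory.measure_mono_null (fun z hz => ?_) (hK e he))
  have hzt := (hWV hz).2
  refine ⟨hzt, fun hc => hno z (hWV hz).1 hzt
    (Eq.trans (congrArg Set.ncard ?_) (hc.trans finrank_euclideanSpace_fin.symm))⟩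
  ext c
  constructor
  · exact HasEigenvalue.of_conj (dchartEquiv he hzt).toLinearEquiv
      fun ξ => dchart_endChart he hzt K ξ
  · refine HasEigenvalue.of_conj (dchartEquiv he hzt).symm.toLinearEquiv fun ξ => ?_
    simp [endChart_eq he hzt]

variable (g₀ g) in
/-- The field of endomorphisms `g₀⁻¹ g`. -/
abbrev sharpEnd : EndField n X := fun x => sharp (g₀.inner x) (g.inner x)

theorem isPositive_sharpEnd (x : X) : IsPositive (sharpEnd g₀ g x) :=
  (g₀.isScalarProduct x).isPositive_sharp (g.isScalarProduct x)

theorem isSigmaOn (he : e ∈ charts n X) (hK : HasDistinctEigenvalues K) (hg : g ∈ SigmaK K g₀) :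
    IsSigmaOn e.target (bilChart e g₀.inner) (endChart e K) (endChart e (sharpEnd g₀ g)) where
  metric := g₀.isMetricOn he
  contDiffOn_K := contDiffOn_endChart he K
  simple := isGenericallySimple he hK
  contDiffOn := ((g₀.isMetricOn he).contDiffOn_inverse.clm_comp
    (g.isMetricOn he).contDiffOn).congr fun y hy => endChart_sharp he hy g₀ g.inner
  isScalarProduct z hz := by
    rw [bilChart_comp_endChart_sharp he hz]
    exact g.isScalarProduct_bilChart he hz
  codazzi z hz ξ η := sub_eq_zero.1 (hg.1.2 e he z hz ξ η)
  -- Order `p = 0` gives the brackets with `K` and with the curvature, order `p = 1` the bracket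
  -- with `∇K`.
  commute_K z hz := (hg.2 e he z hz 0 finZeroElim).1
  commute_cov_K z hz ξ := (hg.2 e he z hz 1 fun _ => ξ).1
  commute_curvature z hz ξ η := (hg.2 e he z hz 0 finZeroElim).2 ξ η

theorem endChart_logEnd (he : e ∈ charts n X) (hy : y ∈ e.target) :
    endChart e (logEnd g₀ g) y = funCalc Real.log (endChart e (sharpEnd g₀ g) y) :=
  endChart_funCalc he hy (A := sharpEnd g₀ g) (isPositive_sharpEnd _) _

theorem rootEnd_eq (x : X) :
    rootEnd g₀ g x = funCalc (fun c => Real.exp (-(1 / 2) * Real.log c)) (sharpEnd g₀ g x) :=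
  (isPositive_sharpEnd x).funCalc_sqrt_of_mul_eq_one
    ((g.isScalarProduct x).sharp_mul_sharp (g₀.isScalarProduct x))

theorem IsPositive.funCalc_exp_mul_log {E : Type*} [NormedAddCommGroup E] [NormedSpace ℝ E]
    [FiniteDimensional ℝ E] {B : E →L[ℝ] E} (hB : IsPositive B) (r : ℝ) :
    funCalc (fun c => Real.exp (r * Real.log c)) B = expEnd (r • funCalc Real.log B) := by
  obtain ⟨b, c, hc, h⟩ := hB
  exact (h.funCalc _).ext (isEigenbasis_smul (h.funCalc _) r).expEnd

theorem endChart_rootEnd (he : e ∈ charts n X) (hK : HasDistinctEigenvalues K)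
    (hg : g ∈ SigmaK K g₀) (hy : y ∈ e.target) :
    endChart e (rootEnd g₀ g) y =
      expEnd ((-(1 / 2) : ℝ) • funCalc Real.log (endChart e (sharpEnd g₀ g) y)) := by
  have h1 : rootEnd g₀ g =
      fun x => funCalc (fun c => Real.exp (-(1 / 2) * Real.log c)) (sharpEnd g₀ g x) :=
    funext rootEnd_eq
  rw [h1, endChart_funCalc he hy (A := sharpEnd g₀ g) (isPositive_sharpEnd _),
    ((isSigmaOn he hK hg).isPositive hy).funCalc_exp_mul_log]

theorem bilChart_eq_comp_expEnd (he : e ∈ charts n X) (hK : HasDistinctEigenvalues K)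
    (hg : g ∈ SigmaK K g₀) (hy : y ∈ e.target) :
    bilChart e g.inner y =
      bilChart e g₀.inner y ∘L expEnd (funCalc Real.log (endChart e (sharpEnd g₀ g) y)) := by
  rw [(isSigmaOn he hK hg).expEnd_log hy, bilChart_comp_endChart_sharp he hy]

theorem VolumeForm.chart_ne_zero (Ω : VolumeForm n X) (he : e ∈ charts n X) (hy : y ∈ e.target) :
    Ω.chart e y ≠ 0 := by
  intro h0
  let b := (stdBasis n).map (dchartEquiv he hy).toLinearEquiv
  exact Ω.ne_zero (e.symm y) ((AlternatingMap.map_basis_eq_zero_iff b _).1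
    (Eq.trans (congrArg _ (funext fun i => by simp [b, ← coe_dchartEquiv he hy])) h0))

theorem ricChart_eq (Ω : VolumeForm n X) (he : e ∈ charts n X) (hK : HasDistinctEigenvalues K)
    (hg : g ∈ SigmaK K g₀) (hy : y ∈ e.target) :
    ricChart Ω e g y =
      ricChart Ω e g₀ y
      - (1 / 2 : ℝ) • omegaLaplacian (stdBasis n) (Ω.chart e) (actBil (Rn n)) (bilChart e g₀.inner)
          (fun z => bilChart e g₀.inner z ∘L endChart e (logEnd g₀ g) z) y
      - (1 / 4 : ℝ) • (bilChart e g₀.inner y ∘L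
          traceSq (stdBasis n) (bilChart e g₀.inner) (endChart e (logEnd g₀ g)) y) := by
  have ht := e.open_target.mem_nhds hy
  have h := (isSigmaOn he hK hg).isCommutingLog
  have h1 : bilChart e g.inner =ᶠ[𝓝 y] fun z => bilChart e g₀.inner z ∘L
      expEnd (funCalc Real.log (endChart e (sharpEnd g₀ g) z)) := by
    filter_upwards [ht] with z hz using bilChart_eq_comp_expEnd he hK hg hz
  have h2 : endChart e (logEnd g₀ g) =ᶠ[𝓝 y]
      fun z => funCalc Real.log (endChart e (sharpEnd g₀ g) z) := by
    filter_upwards [ht] with z hz using endChart_logEnd he hz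
  have h3 : (fun z => bilChart e g₀.inner z ∘L endChart e (logEnd g₀ g) z) =ᶠ[𝓝 y]
      fun z => bilChart e g₀.inner z ∘L funCalc Real.log (endChart e (sharpEnd g₀ g) z) := by
    filter_upwards [h2] with z hz using by rw [hz]
  rw [ricChart, bakryEmery_congr _ h1, h.bakryEmery_eq (w := Ω.chart e) (stdBasis n) (Ω.smooth e he)
    (fun z hz => Ω.chart_ne_zero he hz) hy, omegaLaplacian_congr _ _ h3]
  simp only [traceSq, cov_congr _ h2]
  rfl

theorem ricStarChart_eq (Ω : VolumeForm n X) (he : e ∈ charts n X) (hK : HasDistinctEigenvalues K)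
    (hg : g ∈ SigmaK K g₀) (hy : y ∈ e.target) :
    ricStarChart Ω e g y =
      endChart e (rootEnd g₀ g) y *
          omegaLaplacian (stdBasis n) (Ω.chart e) (actEnd (Rn n)) (bilChart e g₀.inner)
            (endChart e (rootEnd g₀ g)) y
      + endChart e (rootEnd g₀ g) y ^ 2 * ricStarChart Ω e g₀ y := by
  have ht := e.open_target.mem_nhds hy
  have h := (isSigmaOn he hK hg).isCommutingLog
  have h1 : bilChart e g.inner =ᶠ[𝓝 y] fun z => bilChart e g₀.inner z ∘L
      expEnd (funCalc Real.log (endChart e (sharpEnd g₀ g) z)) := by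
    filter_upwards [ht] with z hz using bilChart_eq_comp_expEnd he hK hg hz
  have h2 : endChart e (rootEnd g₀ g) =ᶠ[𝓝 y] fun z => expEnd ((-(1 / 2) : ℝ) •
      funCalc Real.log (endChart e (sharpEnd g₀ g) z)) := by
    filter_upwards [ht] with z hz using endChart_rootEnd he hK hg hz
  rw [ricStarChart, ricChart, bakryEmery_congr _ h1, h1.eq_of_nhds,
    h.sharp_bakryEmery_eq (w := Ω.chart e) (stdBasis n) (Ω.smooth e he) (fun z hz => Ω.chart_ne_zero he hz) hy,
    omegaLaplacian_congr _ _ h2, h2.eq_of_nhds]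
  rfl

theorem contDiffOn_bilChart_comp_funCalc (he : e ∈ charts n X) (hK : HasDistinctEigenvalues K)
    (hg : g ∈ SigmaK K g₀) (r : ℝ) :
    ContDiffOn ℝ ∞ (bilChart e fun x => g₀.inner x ∘L
      funCalc (fun c => Real.exp (r * Real.log c)) (sharpEnd g₀ g x)) e.target := by
  have h := isSigmaOn he hK hg
  refine ((g₀.isMetricOn he).contDiffOn.clm_comp (h.isCommutingLog.contDiffOn_exp r)).congr
    fun y hy => ?_
  rw [← (h.isPositive hy).funCalc_exp_mul_log, ← endChart_funCalc he hy (A := sharpEnd g₀ g)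
    (isPositive_sharpEnd _)]
  ext ξ η
  rw [bilChart_apply, ContinuousLinearMap.comp_apply, ContinuousLinearMap.comp_apply,
    bilChart_apply, dchart_endChart he hy]

/-- The metric `g₀ (g₀⁻¹ g)^r`. -/
def powMetric (hK : HasDistinctEigenvalues K) (hg : g ∈ SigmaK K g₀) (r : ℝ) : RiemMetric n X where
  inner x := g₀.inner x ∘L funCalc (fun c => Real.exp (r * Real.log c)) (sharpEnd g₀ g x)
  symm x := ((g₀.isScalarProduct x).comp_funCalc_exp (g.isScalarProduct x) r).symm
  pos x := ((g₀.isScalarProduct x).comp_funCalc_exp (g.isScalarProduct x) r).pos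
  isVonNBounded x := by
    have hB := isPositive_sharpEnd (g₀ := g₀) (g := g) x
    have h1 := hB.funCalc_exp_mul_log_mul (r / 2) (r / 2)
    have h2 := hB.funCalc_exp_mul_log_mul (-(r / 2)) (r / 2)
    rw [add_halves] at h1
    rw [neg_add_cancel, hB.funCalc_exp_zero] at h2
    -- The unit ball of the metric `g₀ B^r`, where `B = g₀⁻¹ g`, lies in the image under `B^{-r/2}`
    -- of the unit ball of `g₀`.
    have h4 := (g₀.isVonNBounded x).image
      (funCalc (fun c => Real.exp (-(r / 2) * Real.log c)) (sharpEnd g₀ g x))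
    refine h4.subset ?_
    intro v hv
    refine ⟨funCalc (fun c => Real.exp (r / 2 * Real.log c)) (sharpEnd g₀ g x) v, ?_, ?_⟩
    · have h3 := funCalc_selfAdjoint ((g₀.isScalarProduct x).sharp_selfAdjoint (g.symm x))
        (fun c => Real.exp (r / 2 * Real.log c))
        (funCalc (fun c => Real.exp (r / 2 * Real.log c)) (sharpEnd g₀ g x) v) v
      rw [← mul_apply_eq_comp, h1] at h3
      rw [mem_ofPred_eq, ← h3]
      exact hv
    · exact congrArg (fun T : TangentSpace (𝓡 n) x →L[ℝ] TangentSpace (𝓡 n) x => T v) h2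
  contMDiff := contMDiff_of_bilChart fun _ he => contDiffOn_bilChart_comp_funCalc he hK hg r

theorem sharpEnd_powMetric (hK : HasDistinctEigenvalues K) (hg : g ∈ SigmaK K g₀) (r : ℝ) (x : X) :
    sharpEnd g₀ (powMetric hK hg r) x =
      funCalc (fun c => Real.exp (r * Real.log c)) (sharpEnd g₀ g x) :=
  (g₀.isScalarProduct x).sharp_comp _

/-- The brackets vanish at every order because a power of `B` is a polynomial in `B` at each point;
the Codazzi equation follows from `∇ exp (r L) = r exp (r L) ∇L`. -/
theorem powMetric_mem (hK : HasDistinctEigenvalues K) (hg : g ∈ SigmaK K g₀) (r : ℝ) :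
    powMetric hK hg r ∈ SigmaK K g₀ := by
  have h0 : (fun x => sharp (g₀.inner x) ((powMetric hK hg r).toSection x)) =
      fun x => funCalc (fun c => Real.exp (r * Real.log c)) (sharpEnd g₀ g x) :=
    funext fun x => sharpEnd_powMetric hK hg r x
  refine ⟨⟨fun x => (powMetric hK hg r).symm x, fun e he y hy ξ η => ?_⟩,
    fun e he y hy p ξ => ?_⟩
  · rw [h0, extCov_eq_zero_iff]
    have h := isSigmaOn he hK hg
    have h1 : endChart e (fun x => funCalc (fun c => Real.exp (r * Real.log c)) (sharpEnd g₀ g x))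
        =ᶠ[𝓝 y] fun z => expEnd (r • funCalc Real.log (endChart e (sharpEnd g₀ g) z)) := by
      filter_upwards [e.open_target.mem_nhds hy] with z hz
      rw [endChart_funCalc he hz (A := sharpEnd g₀ g) (isPositive_sharpEnd _),
        (h.isPositive hz).funCalc_exp_mul_log]
    rw [cov_congr _ h1, h.isCommutingLog.cov_exp hy, h.isCommutingLog.cov_exp hy]
    simp only [smul_apply, mul_apply_eq_comp, h.isCommutingLog.codazzi y hy ξ η]
  · rw [h0, endChart_funCalc he hy (A := sharpEnd g₀ g) (isPositive_sharpEnd _)]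
    exact ⟨commute_funCalc (hg.2 e he y hy p ξ).1 _,
      fun ζ η => commute_funCalc ((hg.2 e he y hy p ξ).2 ζ η) _⟩

theorem RiemMetric.eq_of_sharpEnd (hgh : sharpEnd g₀ g = sharpEnd g₀ h) : g = h := by
  have h1 : g.inner = h.inner := funext fun x => by
    have h2 : sharp (g₀.inner x) (g.inner x) = sharp (g₀.inner x) (h.inner x) := congrFun hgh x
    rw [← (g₀.isScalarProduct x).comp_sharp (g.inner x), h2, (g₀.isScalarProduct x).comp_sharp]
  cases g; cases h; cases h1; rfl

/-- The metric is determined by `H`: `g₀⁻¹ g = H⁻²`. -/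
theorem sharpEnd_eq_of_rootEnd (x : X) :
    sharpEnd g₀ g x = funCalc (fun c => Real.exp (-2 * Real.log c)) (rootEnd g₀ g x) := by
  have hB := isPositive_sharpEnd (g₀ := g₀) (g := g) x
  rw [rootEnd_eq, hB.funCalc_comp]
  conv_lhs => rw [← hB.funCalc_exp_one]
  congr 1
  funext c
  rw [Real.log_exp]
  ring_nf

theorem bijOn_rootEnd (hK : HasDistinctEigenvalues K) :
    BijOn (rootEnd g₀) (SigmaK K g₀) (SigmaKEnd K g₀) := by
  refine ⟨fun g hg => ⟨powMetric hK hg (-(1 / 2)), powMetric_mem hK hg _, funext fun x => ?_⟩,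
    fun g _ h _ hgh => RiemMetric.eq_of_sharpEnd (g₀ := g₀) (funext fun x => ?_), ?_⟩
  · exact (sharpEnd_powMetric hK hg _ x).trans (rootEnd_eq x).symm
  · rw [sharpEnd_eq_of_rootEnd, hgh, ← sharpEnd_eq_of_rootEnd]
  · rintro _ ⟨h, hh, rfl⟩
    -- The preimage of `H` is the metric with `g₀⁻¹ g = H⁻²`.
    refine ⟨powMetric hK hh (-2), powMetric_mem hK hh _, funext fun x => ?_⟩
    have hB := isPositive_sharpEnd (g₀ := g₀) (g := h) x
    rw [rootEnd_eq, sharpEnd_powMetric, hB.funCalc_comp]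
    refine Eq.trans ?_ hB.funCalc_exp_one
    congr 1
    funext c
    rw [Real.log_exp]
    ring_nf

theorem eq_iff_rootEnd_eq_id :
    g = g₀ ↔ rootEnd g₀ g = fun x => ContinuousLinearMap.id ℝ (TangentSpace (𝓡 n) x) := by
  have h1 : ∀ x, sharpEnd g₀ g₀ x = 1 := fun x => (g₀.isScalarProduct x).sharp_comp 1
  have h2 : ∀ x, rootEnd g₀ g₀ x = 1 := by
    intro x
    obtain ⟨b, -, -, -⟩ := isPositive_sharpEnd (g₀ := g₀) (g := g₀) x
    have h : IsEigenbasis b (fun _ => 1) (1 : TangentSpace (𝓡 n) x →L[ℝ] TangentSpace (𝓡 n) x) :=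
      fun i => by simp
    rw [rootEnd_eq, h1]
    exact (h.funCalc _).ext fun i => by simp
  constructor
  · rintro rfl
    exact funext h2
  · intro h
    refine RiemMetric.eq_of_sharpEnd (g₀ := g₀) (funext fun x => ?_)
    rw [sharpEnd_eq_of_rootEnd, sharpEnd_eq_of_rootEnd (g := g₀), h2, h]
    rfl

end Manifold

/-! ### Time-dependent logarithms. -/

section Coordinates

theorem IsPositive.expEnd_smul_log {E : Type*} [NormedAddCommGroup E] [NormedSpace ℝ E]
    [FiniteDimensional ℝ E] {B : E →L[ℝ] E} (hB : IsPositive B) (r : ℝ) :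
    IsPositive (expEnd (r • funCalc Real.log B)) ∧
      logInt (expEnd (r • funCalc Real.log B)) = r • funCalc Real.log B := by
  have hP : IsPositive (expEnd (r • funCalc Real.log B)) := by
    obtain ⟨b, c, -, h⟩ := hB
    exact ⟨b, _, fun i => Real.exp_pos _, (isEigenbasis_smul (h.funCalc Real.log) r).expEnd⟩
  refine ⟨hP, ?_⟩
  rw [← funCalc_log hP, ← hB.funCalc_exp_mul_log, hB.funCalc_comp]
  obtain ⟨b, c, -, h⟩ := hB
  exact (h.funCalc _).ext fun i => by
    simp only [Real.log_exp, isEigenbasis_smul (h.funCalc Real.log) r i]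

variable {E : Type} [NormedAddCommGroup E] [NormedSpace ℝ E] [FiniteDimensional ℝ E]
  {F : Type} [NormedAddCommGroup F] [NormedSpace ℝ F]
  {J : Set ℝ} {U : Set E} {t : ℝ} {y : E}

/-- The smooth `logInt` recovers `r L` from `exp (r L)`. With `r = 1` and `r = -1/2` it shows that
the metrics and the `H_t` have the same smoothness. -/
theorem contDiffOn_expEnd_smul_log_iff {W : Type*} [NormedAddCommGroup W] [NormedSpace ℝ W]
    {S : Set W} {B : W → E →L[ℝ] E} (hB : ∀ q ∈ S, IsPositive (B q)) {r : ℝ} (hr : r ≠ 0) :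
    ContDiffOn ℝ ∞ (fun q => expEnd (r • funCalc Real.log (B q))) S ↔
      ContDiffOn ℝ ∞ (fun q => funCalc Real.log (B q)) S := by
  refine ⟨fun h => ?_, fun h => contDiff_expEnd.comp_contDiffOn (h.const_smul r)⟩
  have h1 : ContDiffOn ℝ ∞ (fun q => logInt (expEnd (r • funCalc Real.log (B q)))) S :=
    fun q hq => ContDiffAt.comp_contDiffWithinAt q (g := logInt)
      (f := fun q => expEnd (r • funCalc Real.log (B q)))
      (contDiffAt_logInt ((hB q hq).expEnd_smul_log r).1) (h q hq)
  refine (h1.const_smul r⁻¹).congr fun q hq => ?_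
  rw [((hB q hq).expEnd_smul_log r).2, inv_smul_smul₀ hr]

theorem Commute.hasDerivWithinAt {L : ℝ → E →L[ℝ] E} {M D : E →L[ℝ] E}
    (hc : ∀ s ∈ J, Commute M (L s)) (h : HasDerivWithinAt L D J t) (ht : t ∈ J)
    (hu : UniqueDiffWithinAt ℝ J t) : Commute M D := by
  have h1 : HasDerivWithinAt (fun s => M * L s - L s * M) (M * D - D * M) J t :=
    (h.const_mul M).sub (h.mul_const M)
  have h2 : HasDerivWithinAt (fun s => M * L s - L s * M) 0 J t :=
    (hasDerivWithinAt_const t J 0).congr (fun s hs => sub_eq_zero.2 (hc s hs))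
      (sub_eq_zero.2 (hc t ht))
  exact sub_eq_zero.1 (hu.eq_deriv _ h1 h2)

theorem hasDerivWithinAt_expEnd_smul {L : ℝ → E →L[ℝ] E} {D : E →L[ℝ] E}
    (h : HasDerivWithinAt L D J t) (hc : Commute (L t) D) (r : ℝ) :
    HasDerivWithinAt (fun s => expEnd (r • L s)) (expEnd (r • L t) * (r • D)) J t := by
  have hd : HasFDerivAt (expEnd : (E →L[ℝ] E) → _) (fderiv ℝ expEnd (r • L t)) (r • L t) :=
    (contDiff_expEnd.differentiable (by simp) _).hasFDerivAt
  rw [← fderiv_expEnd_of_commute ((hc.smul_left r).smul_right r)]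
  exact hd.comp_hasDerivWithinAt t (h.const_smul r)

theorem isUnit_expEnd (A : E →L[ℝ] E) : IsUnit (expEnd A) := by
  have h1 : Commute A (-A) := (Commute.refl A).neg_right
  refine ⟨⟨expEnd A, expEnd (-A), ?_, ?_⟩, rfl⟩
  · rw [← expEnd_add h1, add_neg_cancel, expEnd_zero]
  · rw [← expEnd_add h1.symm, neg_add_cancel, expEnd_zero]

/-- Since `L t` commutes with every `L s`, it commutes with the derivative, and the exponential is
differentiated as for scalars. For the converse, cancel the invertible `exp (r L t)` and the factor
`r`. -/
theorem hasDerivWithinAt_expEnd_smul_iff {L : ℝ → E →L[ℝ] E} {D : E →L[ℝ] E}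
    (hL : DifferentiableWithinAt ℝ L J t) (hc : ∀ s ∈ J, Commute (L t) (L s)) (ht : t ∈ J)
    (hu : UniqueDiffWithinAt ℝ J t) {r : ℝ} (hr : r ≠ 0) :
    HasDerivWithinAt (fun s => expEnd (r • L s)) (expEnd (r • L t) * (r • D)) J t ↔
      HasDerivWithinAt L D J t := by
  refine ⟨fun h => ?_, fun h => hasDerivWithinAt_expEnd_smul h (Commute.hasDerivWithinAt hc h ht hu) r⟩
  have h1 := hL.hasDerivWithinAt
  have h2 := hasDerivWithinAt_expEnd_smul h1 (Commute.hasDerivWithinAt hc h1 ht hu) r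
  have h3 := smul_right_injective _ hr ((isUnit_expEnd _).mul_left_cancel (hu.eq_deriv _ h h2))
  exact h3 ▸ h1

/-- Differentiation in space commutes with differentiation in time. -/
theorem hasDerivWithinAt_fderiv {A : ℝ → E → F}
    (hA : ContDiffOn ℝ ∞ (fun q : ℝ × E => A q.1 q.2) (J ×ˢ U)) (hJ : Convex ℝ J)
    (hJi : (interior J).Nonempty) (hU : IsOpen U) (ht : t ∈ J) (hy : y ∈ U) {D : E → F}
    (hD : ∀ z ∈ U, HasDerivWithinAt (fun s => A s z) (D z) J t) :
    DifferentiableAt ℝ D y ∧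
      HasDerivWithinAt (fun s => fderiv ℝ (A s) y) (fderiv ℝ D y) J t := by
  have huJ := uniqueDiffOn_convex hJ hJi
  have hu : UniqueDiffOn ℝ (J ×ˢ U) := huJ.prod hU.uniqueDiffOn
  set f : ℝ × E → F := fun q => A q.1 q.2
  set f' : ℝ × E → ℝ × E →L[ℝ] F := fderivWithin ℝ f (J ×ˢ U)
  have hf : ∀ q ∈ J ×ˢ U, HasFDerivWithinAt f (f' q) (J ×ˢ U) q := fun q hq =>
    (hA.differentiableOn (by simp) q hq).hasFDerivWithinAt
  have hf' : HasFDerivWithinAt f' (fderivWithin ℝ f' (J ×ˢ U) (t, y)) (J ×ˢ U) (t, y) :=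
    ((hA.fderivWithin (m := 1) hu two_le_infty).differentiableOn (by simp) _
      ⟨ht, hy⟩).hasFDerivWithinAt
  have hsymm : IsSymmSndFDerivWithinAt ℝ f (J ×ˢ U) (t, y) := by
    refine (hA (t, y) ⟨ht, hy⟩).isSymmSndFDerivWithinAt ?_ hu ?_ ⟨ht, hy⟩
    · simpa using ENat.LEInfty.out
    -- Second derivatives within `J ×ˢ U` are symmetric at limits of interior points, which includes
    -- the endpoints of `J` that belong to it.
    · rw [interior_prod_eq, closure_prod_eq, hU.interior_eq, hJ.closure_interior_eq_closure_of_nonempty_interior hJi]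
      exact ⟨subset_closure ht, subset_closure hy⟩
  have hspace : ∀ s ∈ J, ∀ z, HasFDerivAt (fun z : E => ((s, z) : ℝ × E))
      (ContinuousLinearMap.inr ℝ ℝ E) z := fun s _ z => hasFDerivAt_prodMk_right s z
  have htime : ∀ s, ∀ z, HasFDerivAt (fun s : ℝ => ((s, z) : ℝ × E))
      (ContinuousLinearMap.inl ℝ ℝ E) s := fun s z => hasFDerivAt_prodMk_left s z
  have hmaps : MapsTo (fun z : E => ((t, z) : ℝ × E)) U (J ×ˢ U) := fun z hz => ⟨ht, hz⟩
  have hmaps' : ∀ z ∈ U, MapsTo (fun s : ℝ => ((s, z) : ℝ × E)) J (J ×ˢ U) :=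
    fun z hz s hs => ⟨hs, hz⟩
  have hD' : ∀ z ∈ U, D z = f' (t, z) (1, 0) := by
    intro z hz
    have h1 := ((hf (t, z) ⟨ht, hz⟩).comp t (htime t z).hasFDerivWithinAt
      (hmaps' z hz)).hasDerivWithinAt
    exact (huJ t ht).eq_deriv _ (hD z hz) h1
  have hfd : ∀ s ∈ J, fderiv ℝ (A s) y = f' (s, y) ∘L ContinuousLinearMap.inr ℝ ℝ E := by
    intro s hs
    have h1 := ((hf (s, y) ⟨hs, hy⟩).comp y (hspace s hs y).hasFDerivWithinAt
      (fun z hz => ⟨hs, hz⟩ : MapsTo (fun z : E => ((s, z) : ℝ × E)) U (J ×ˢ U)))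
    exact (h1.hasFDerivAt (hU.mem_nhds hy)).fderiv
  have h2 : HasFDerivAt (fun z => f' (t, z))
      (fderivWithin ℝ f' (J ×ˢ U) (t, y) ∘L ContinuousLinearMap.inr ℝ ℝ E) y :=
    (hf'.comp y (hspace t ht y).hasFDerivWithinAt hmaps).hasFDerivAt (hU.mem_nhds hy)
  have h3 : HasFDerivAt D _ y :=
    (h2.clm_apply (hasFDerivAt_const (((1 : ℝ), (0 : E)) : ℝ × E) y)).congr_of_eventuallyEq
      (Filter.eventually_of_mem (hU.mem_nhds hy) hD')
  refine ⟨h3.differentiableAt, ?_⟩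
  have h4 := (hf'.comp t (htime t y).hasFDerivWithinAt (hmaps' y hy)).hasDerivWithinAt
  have h5 := (((ContinuousLinearMap.compL ℝ E (ℝ × E) F).flip
    (ContinuousLinearMap.inr ℝ ℝ E)).hasFDerivAt.comp_hasDerivWithinAt t h4).congr hfd (hfd t ht)
  refine h5.congr_deriv ?_
  ext ξ
  rw [h3.fderiv]
  simpa using hsymm (1, 0) (0, ξ)

/-- If the logarithms `L_s` are Codazzi and commute, then the time derivative of `L` is Codazzi for
each of the metrics `g exp L_t`. -/
theorem extCov_deriv_eq_zero {g : E → E →L[ℝ] E →L[ℝ] ℝ} {L : ℝ → E → E →L[ℝ] E}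
    (hL : ContDiffOn ℝ ∞ (fun q : ℝ × E => L q.1 q.2) (J ×ˢ U)) (hJ : Convex ℝ J)
    (hJi : (interior J).Nonempty) (hg : ∀ s ∈ J, IsCommutingLog U g (L s)) (ht : t ∈ J) (hy : y ∈ U)
    (hc : ∀ s ∈ J, ∀ ξ, Commute (cov (actEnd E) g (L t) y ξ) (L s y)) {D : E → E →L[ℝ] E}
    (hD : ∀ z ∈ U, HasDerivWithinAt (fun s => L s z) (D z) J t) (ξ η : E) :
    extCov (fun z => g z ∘L expEnd (L t z)) D y ξ η = 0 := by
  have hu := uniqueDiffOn_convex hJ hJi t ht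
  obtain ⟨-, h1⟩ := hasDerivWithinAt_fderiv hL hJ hJi (hg t ht).metric.isOpen ht hy hD
  have h2 : ∀ ξ η, HasDerivWithinAt (fun s => cov (actEnd E) g (L s) y ξ η)
      (cov (actEnd E) g D y ξ η) J t := by
    intro ξ η
    simp only [cov_end_apply, sub_apply, add_apply, mul_apply_eq_comp]
    have h3 := hD y hy
    have h4 := (h1.clm_apply (hasDerivWithinAt_const t J ξ)).clm_apply (hasDerivWithinAt_const t J η)
    have h5 := h3.clm_apply (hasDerivWithinAt_const t J η)
    have h6 := h3.clm_apply (hasDerivWithinAt_const t J (christoffel g y ξ η))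
    have h7 := (christoffel g y ξ).hasFDerivAt.comp_hasDerivWithinAt t h5
    exact (h4.add (h7.sub h6)).congr_deriv (by simp)
  -- For the fixed metric `g` the Codazzi equation is linear in `L`, so it passes to the time
  -- derivative.
  have h3 : cov (actEnd E) g D y ξ η - cov (actEnd E) g D y η ξ = 0 :=
    hu.eq_deriv _ ((h2 ξ η).sub (h2 η ξ)) ((hasDerivWithinAt_const t J 0).congr
      (fun s hs => sub_eq_zero.2 ((hg s hs).codazzi y hy ξ η))
      (sub_eq_zero.2 ((hg t ht).codazzi y hy ξ η)))
  -- The connections of `g exp L_t` and `g` differ by `½ ∇L_t`, which commutes with every `L_s`,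
  -- hence with `D`.
  have h4 : ∀ ξ, cov (actEnd E) (fun z => g z ∘L expEnd (L t z)) D y ξ = cov (actEnd E) g D y ξ := by
    intro ξ
    have h5 := (Commute.hasDerivWithinAt (fun s hs => hc s hs ξ) (hD y hy) ht hu).eq
    rw [cov_end_apply, cov_end_apply, (hg t ht).christoffel_eq hy, add_apply, smul_apply, add_mul,
      mul_add, smul_mul_assoc, mul_smul_comm, h5]
    abel
  rw [extCov, h4, h4, h3]

end Coordinates

theorem convex_timeInterval (T : EReal) : Convex ℝ (timeInterval T) := by
  refine Set.OrdConnected.convex ⟨fun a ha b hb c hc => ⟨ha.1.trans hc.1, ?_⟩⟩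
  exact (EReal.coe_le_coe_iff.2 hc.2).trans_lt hb.2

/-- Together with convexity this gives uniqueness of derivatives within the interval, time `0`
included. -/
theorem interior_timeInterval_nonempty {T : EReal} (hT : 0 < T) :
    (interior (timeInterval T)).Nonempty := by
  obtain ⟨r, h0, hr⟩ := EReal.lt_iff_exists_real_btwn.1 hT
  have h0' : 0 < r := EReal.coe_pos.1 h0
  refine ⟨r / 2, mem_interior.2 ⟨Ioo 0 r, fun s hs => ⟨hs.1.le, ?_⟩, isOpen_Ioo, by
    constructor <;> linarith⟩⟩
  exact (EReal.coe_lt_coe_iff.2 hs.2).trans hr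

/-! ### Equivalence of the two flows. -/

section Manifold

variable {n : ℕ} {X : Type*} [TopologicalSpace X] [ChartedSpace (Rn n) X]
  [IsManifold (𝓡 n) ∞ X] {e : OpenPartialHomeomorph X (Rn n)} {y : Rn n}
  {K : EndSection n X} {g₀ g' : RiemMetric n X} {Ω : VolumeForm n X}
  {J : Set ℝ} {g : ℝ → RiemMetric n X} {t s : ℝ}

/-- Both logarithms commute with `K`. Applied to two times of one family, this is what makes the
time derivative of the exponential scalar-like. -/
theorem commute_log_log (he : e ∈ charts n X) (hK : HasDistinctEigenvalues K)
    (h : g' ∈ SigmaK K g₀) {h' : RiemMetric n X} (hh' : h' ∈ SigmaK K g₀) (hy : y ∈ e.target) :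
    Commute (funCalc Real.log (endChart e (sharpEnd g₀ g') y))
      (funCalc Real.log (endChart e (sharpEnd g₀ h') y)) :=
  (isGenericallySimple he hK).commute e.open_target
    (isSigmaOn he hK h).contDiffOn_log.continuousOn (isSigmaOn he hK hh').contDiffOn_log.continuousOn
    (fun _ hz => (isSigmaOn he hK h).commute_log hz) (fun _ hz => (isSigmaOn he hK hh').commute_log hz) hy

theorem commute_cov_log_log (he : e ∈ charts n X) (hK : HasDistinctEigenvalues K)
    (h : g' ∈ SigmaK K g₀) {h' : RiemMetric n X} (hh' : h' ∈ SigmaK K g₀) (hy : y ∈ e.target)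
    (ξ : Rn n) :
    Commute (cov (actEnd (Rn n)) (bilChart e g₀.inner)
        (fun z => funCalc Real.log (endChart e (sharpEnd g₀ g') z)) y ξ)
      (funCalc Real.log (endChart e (sharpEnd g₀ h') y)) :=
  (isGenericallySimple he hK).commute e.open_target
    ((isSigmaOn he hK h).isCommutingLog.contDiffOn_cov.continuousOn.clm_apply continuousOn_const)
    (isSigmaOn he hK hh').contDiffOn_log.continuousOn
    (fun _ hz => (isSigmaOn he hK h).commute_K_cov_log hz ξ)
    (fun _ hz => (isSigmaOn he hK hh').commute_log hz) hy

/-- The smoothness of `(g_t)` in terms of `log (g₀⁻¹ g_t)`. -/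
theorem contDiffOn_bilChart_iff (he : e ∈ charts n X) (hK : HasDistinctEigenvalues K)
    (hg : ∀ t ∈ J, g t ∈ SigmaK K g₀) :
    ContDiffOn ℝ ∞ (fun q : ℝ × Rn n => bilChart e (g q.1).inner q.2) (J ×ˢ e.target) ↔
      ContDiffOn ℝ ∞ (fun q : ℝ × Rn n => funCalc Real.log (endChart e (sharpEnd g₀ (g q.1)) q.2))
        (J ×ˢ e.target) := by
  rw [← contDiffOn_expEnd_smul_log_iff (r := 1)
    (fun q hq => (isSigmaOn he hK (hg q.1 hq.1)).isPositive hq.2) one_ne_zero]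
  have hsnd : MapsTo (Prod.snd : ℝ × Rn n → Rn n) (J ×ˢ e.target) e.target := fun q hq => hq.2
  constructor <;> intro h
  · refine (((g₀.isMetricOn he).contDiffOn_inverse.comp contDiffOn_snd hsnd).clm_comp h).congr
      fun q hq => ?_
    rw [one_smul, (isSigmaOn he hK (hg q.1 hq.1)).expEnd_log hq.2, endChart_sharp he hq.2]
    rfl
  · refine (((g₀.isMetricOn he).contDiffOn.comp contDiffOn_snd hsnd).clm_comp h).congr
      fun q hq => ?_
    rw [one_smul, bilChart_eq_comp_expEnd he hK (hg q.1 hq.1) hq.2]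
    rfl

/-- The smoothness of `(H_t)` in terms of `log (g₀⁻¹ g_t)`. -/
theorem contDiffOn_rootEnd_iff (he : e ∈ charts n X) (hK : HasDistinctEigenvalues K)
    (hg : ∀ t ∈ J, g t ∈ SigmaK K g₀) :
    ContDiffOn ℝ ∞ (fun q : ℝ × Rn n => endChart e (rootEnd g₀ (g q.1)) q.2) (J ×ˢ e.target) ↔
      ContDiffOn ℝ ∞ (fun q : ℝ × Rn n => funCalc Real.log (endChart e (sharpEnd g₀ (g q.1)) q.2))
        (J ×ˢ e.target) := by
  rw [← contDiffOn_expEnd_smul_log_iff (r := (-(1 / 2) : ℝ))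
    (fun q hq => (isSigmaOn he hK (hg q.1 hq.1)).isPositive hq.2) (by norm_num)]
  exact contDiffOn_congr fun q hq => endChart_rootEnd he hK (hg q.1 hq.1) hq.2

/-- The evolution equation of `(g_t)` in terms of `log (g₀⁻¹ g_t)`. -/
theorem hasDerivWithinAt_bilChart_iff (Ω : VolumeForm n X) (he : e ∈ charts n X)
    (hK : HasDistinctEigenvalues K) (hg : ∀ t ∈ J, g t ∈ SigmaK K g₀) (hy : y ∈ e.target)
    (ht : t ∈ J) (hu : UniqueDiffWithinAt ℝ J t)
    (hd : DifferentiableWithinAt ℝ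
      (fun s => funCalc Real.log (endChart e (sharpEnd g₀ (g s)) y)) J t) :
    HasDerivWithinAt (fun s => bilChart e (g s).inner y)
        (ricChart Ω e (g t) y - bilChart e (g t).inner y) J t ↔
      HasDerivWithinAt (fun s => funCalc Real.log (endChart e (sharpEnd g₀ (g s)) y))
        (ricStarChart Ω e (g t) y - 1) J t := by
  rw [← hasDerivWithinAt_expEnd_smul_iff hd
    (fun s hs => commute_log_log he hK (hg t ht) (hg s hs) hy) ht hu one_ne_zero]
  have h0 := g₀.isScalarProduct_bilChart he hy
  have h1 : ∀ s ∈ J, bilChart e (g s).inner y = bilChart e g₀.inner y ∘L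
      expEnd ((1 : ℝ) • funCalc Real.log (endChart e (sharpEnd g₀ (g s)) y)) := fun s hs => by
    rw [one_smul, bilChart_eq_comp_expEnd he hK (hg s hs) hy]
  -- `Ric - g_t = g_t (Ric* - 1)` and `g_t = g₀ exp L_t`: this is the time derivative of `g₀ exp
  -- L_t` when `L̇_t = Ric* - 1`.
  have h2 : ricChart Ω e (g t) y - bilChart e (g t).inner y = bilChart e g₀.inner y ∘L
      (expEnd ((1 : ℝ) • funCalc Real.log (endChart e (sharpEnd g₀ (g t)) y)) *
        ((1 : ℝ) • (ricStarChart Ω e (g t) y - 1))) := by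
    have h3 := ((g t).isScalarProduct_bilChart he hy).comp_sharp (ricChart Ω e (g t) y)
    change bilChart e (g t).inner y ∘L ricStarChart Ω e (g t) y = _ at h3
    conv_lhs => rw [← h3]
    rw [h1 t ht, one_smul ℝ (ricStarChart Ω e (g t) y - 1)]
    ext ξ η
    simp
  constructor <;> intro h
  · have h3 := ((ContinuousLinearMap.compL ℝ (Rn n) (Rn n →L[ℝ] ℝ) (Rn n)
      (bilChart e g₀.inner y).inverse).hasFDerivAt.comp_hasDerivWithinAt t h)
    have h4 : ∀ s ∈ J, expEnd ((1 : ℝ) • funCalc Real.log (endChart e (sharpEnd g₀ (g s)) y)) =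
        (bilChart e g₀.inner y).inverse ∘L bilChart e (g s).inner y := fun s hs => by
      rw [h1 s hs]
      exact (h0.sharp_comp _).symm
    refine (h3.congr h4 (h4 t ht)).congr_deriv ?_
    rw [h2]
    exact h0.sharp_comp _
  · have h3 := ((ContinuousLinearMap.compL ℝ (Rn n) (Rn n) (Rn n →L[ℝ] ℝ)
      (bilChart e g₀.inner y)).hasFDerivAt.comp_hasDerivWithinAt t h)
    rw [h2]
    exact h3.congr h1 (h1 t ht)

/-- The evolution equation of `(H_t)` in terms of `log (g₀⁻¹ g_t)`. -/
theorem hasDerivWithinAt_rootEnd_iff (Ω : VolumeForm n X) (he : e ∈ charts n X)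
    (hK : HasDistinctEigenvalues K) (hg : ∀ t ∈ J, g t ∈ SigmaK K g₀) (hy : y ∈ e.target)
    (ht : t ∈ J) (hu : UniqueDiffWithinAt ℝ J t)
    (hd : DifferentiableWithinAt ℝ
      (fun s => funCalc Real.log (endChart e (sharpEnd g₀ (g s)) y)) J t) :
    (∃ D : Endo n, HasDerivWithinAt (fun s => endChart e (rootEnd g₀ (g s)) y) D J t ∧
      (2 : ℝ) • D =
        - (endChart e (rootEnd g₀ (g t)) y ^ 2 *
            omegaLaplacian (stdBasis n) (Ω.chart e) (actEnd (Rn n)) (bilChart e g₀.inner)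
              (endChart e (rootEnd g₀ (g t))) y)
        - endChart e (rootEnd g₀ (g t)) y ^ 3 * ricStarChart Ω e g₀ y
        + endChart e (rootEnd g₀ (g t)) y) ↔
      HasDerivWithinAt (fun s => funCalc Real.log (endChart e (sharpEnd g₀ (g s)) y))
        (ricStarChart Ω e (g t) y - 1) J t := by
  rw [← hasDerivWithinAt_expEnd_smul_iff hd
    (fun s hs => commute_log_log he hK (hg t ht) (hg s hs) hy) ht hu
    (r := (-(1 / 2) : ℝ)) (by norm_num)]
  have h1 : ∀ s ∈ J, endChart e (rootEnd g₀ (g s)) y =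
      expEnd ((-(1 / 2) : ℝ) • funCalc Real.log (endChart e (sharpEnd g₀ (g s)) y)) :=
    fun s hs => endChart_rootEnd he hK (hg s hs) hy
  -- By formula (2) the right-hand side is `-H (Ric* - 1)`, that is `2 Ḣ` for `H = exp (-L/2)` and
  -- `L̇ = Ric* - 1`.
  have h2 : - (endChart e (rootEnd g₀ (g t)) y ^ 2 *
            omegaLaplacian (stdBasis n) (Ω.chart e) (actEnd (Rn n)) (bilChart e g₀.inner)
              (endChart e (rootEnd g₀ (g t))) y)
        - endChart e (rootEnd g₀ (g t)) y ^ 3 * ricStarChart Ω e g₀ y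
        + endChart e (rootEnd g₀ (g t)) y = (2 : ℝ) •
      (expEnd ((-(1 / 2) : ℝ) • funCalc Real.log (endChart e (sharpEnd g₀ (g t)) y)) *
        ((-(1 / 2) : ℝ) • (ricStarChart Ω e (g t) y - 1))) := by
    rw [ricStarChart_eq Ω he hK (hg t ht) hy, ← h1 t ht, mul_smul_comm, smul_smul]
    norm_num
    noncomm_ring
  rw [h2]
  constructor
  · rintro ⟨D, h3, h4⟩
    rw [← smul_right_injective _ (two_ne_zero (α := ℝ)) h4]
    exact h3.congr (fun s hs => (h1 s hs).symm) (h1 t ht).symm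
  · exact fun h => ⟨_, h.congr h1 (h1 t ht), rfl⟩

theorem isSolitonRicciFlow_iff (hJ : Convex ℝ J) (hJi : (interior J).Nonempty)
    (hK : HasDistinctEigenvalues K) (hg : ∀ t ∈ J, g t ∈ SigmaK K g₀) :
    IsSolitonRicciFlow Ω J g ↔ IsPorousMediumFlow Ω g₀ J fun t => rootEnd g₀ (g t) := by
  have hu := uniqueDiffOn_convex hJ hJi
  have hd : ∀ {e : OpenPartialHomeomorph X (Rn n)}, ContDiffOn ℝ ∞ (fun q : ℝ × Rn n =>
      funCalc Real.log (endChart e (sharpEnd g₀ (g q.1)) q.2)) (J ×ˢ e.target) →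
      ∀ y ∈ e.target, ∀ t ∈ J, DifferentiableWithinAt ℝ
        (fun s => funCalc Real.log (endChart e (sharpEnd g₀ (g s)) y)) J t :=
    fun {e} h y hy t ht => by
      have h1 : MapsTo (fun s : ℝ => ((s, y) : ℝ × Rn n)) J (J ×ˢ e.target) := fun s hs => ⟨hs, hy⟩
      exact (h.differentiableOn (by simp) (t, y) ⟨ht, hy⟩).comp t
        (hasFDerivAt_prodMk_left t y).differentiableAt.differentiableWithinAt h1
  constructor
  · intro h
    refine ⟨fun e he => ?_, fun e he y hy t ht => ?_⟩
    · exact (contDiffOn_rootEnd_iff he hK hg).2 ((contDiffOn_bilChart_iff he hK hg).1 (h.smooth e he))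
    · have h1 := hd ((contDiffOn_bilChart_iff he hK hg).1 (h.smooth e he)) y hy t ht
      exact (hasDerivWithinAt_rootEnd_iff Ω he hK hg hy ht (hu t ht) h1).2
        ((hasDerivWithinAt_bilChart_iff Ω he hK hg hy ht (hu t ht) h1).1 (h.evolution e he y hy t ht))
  · intro h
    have hs : ∀ e ∈ charts n X, ContDiffOn ℝ ∞ (fun q : ℝ × Rn n =>
        funCalc Real.log (endChart e (sharpEnd g₀ (g q.1)) q.2)) (J ×ˢ e.target) := fun e he => (contDiffOn_rootEnd_iff he hK hg).1 (h.smooth e he)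
    have hev : ∀ e ∈ charts n X, ∀ y ∈ e.target, ∀ t ∈ J, HasDerivWithinAt
        (fun s => funCalc Real.log (endChart e (sharpEnd g₀ (g s)) y))
        (ricStarChart Ω e (g t) y - 1) J t := fun e he y hy t ht =>
      (hasDerivWithinAt_rootEnd_iff Ω he hK hg hy ht (hu t ht) (hd (hs e he) y hy t ht)).1
        (h.evolution e he y hy t ht)
    refine ⟨fun e he => (contDiffOn_bilChart_iff he hK hg).2 (hs e he), fun t ht e he y hy ξ η => ?_,
      fun e he y hy t ht => (hasDerivWithinAt_bilChart_iff Ω he hK hg hy ht (hu t ht)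
        (hd (hs e he) y hy t ht)).2 (hev e he y hy t ht)⟩
    -- Membership in `𝓢_Ω` follows from the equation: `Ric* - 1` is the time derivative of `L`, and
    -- subtracting the identity does not change the covariant derivative.
    have h1 := extCov_deriv_eq_zero (hs e he) hJ hJi
      (fun s hs => (isSigmaOn he hK (hg s hs)).isCommutingLog) ht hy
      (fun s hs ξ => commute_cov_log_log he hK (hg t ht) (hg s hs) hy ξ)
      (fun z hz => hev e he z hz t ht) ξ η
    have h2 : bilChart e (g t).inner =ᶠ[𝓝 y] fun z => bilChart e g₀.inner z ∘L
        expEnd (funCalc Real.log (endChart e (sharpEnd g₀ (g t)) z)) := by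
      filter_upwards [e.open_target.mem_nhds hy] with z hz
        using bilChart_eq_comp_expEnd he hK (hg t ht) hz
    simpa [extCov, cov_end_apply, christoffel_congr h2, fderiv_sub_const] using h1

end Manifold

end SolitonRicci

end

open SolitonRicci in
theorem mainTheorem5 {n : ℕ} {X : Type*} [TopologicalSpace X] [T2Space X] [SigmaCompactSpace X]
    [ChartedSpace (Rn n) X] [IsManifold (𝓡 n) ∞ X]
    (Ω : VolumeForm n X) (K : EndSection n X) (hK : HasDistinctEigenvalues K)
    (g₀ : RiemMetric n X) :
    -- the expression of `Ric_g (Ω)` through `log (g₀⁻¹ g)`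
    (∀ g ∈ SigmaK K g₀, ∀ e ∈ charts n X, ∀ y ∈ e.target,
      ricChart Ω e g y =
        ricChart Ω e g₀ y
        - (1 / 2 : ℝ) • omegaLaplacian (stdBasis n) (Ω.chart e) (actBil (Rn n)) (bilChart e g₀.inner)
            (fun z => bilChart e g₀.inner z ∘L endChart e (logEnd g₀ g) z) y
        - (1 / 4 : ℝ) • (bilChart e g₀.inner y ∘L
            traceSq (stdBasis n) (bilChart e g₀.inner) (endChart e (logEnd g₀ g)) y)) ∧
    -- the expression of `Ric*_g (Ω)` through `H = (g⁻¹ g₀)^{1/2}`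
    (∀ g ∈ SigmaK K g₀, ∀ e ∈ charts n X, ∀ y ∈ e.target,
      ricStarChart Ω e g y =
        endChart e (rootEnd g₀ g) y *
            omegaLaplacian (stdBasis n) (Ω.chart e) (actEnd (Rn n)) (bilChart e g₀.inner)
              (endChart e (rootEnd g₀ g)) y
        + endChart e (rootEnd g₀ g) y ^ 2 * ricStarChart Ω e g₀ y) ∧
    -- the identification `g ↦ H`
    BijOn (rootEnd g₀) (SigmaK K g₀) (SigmaKEnd K g₀) ∧
    -- the equivalence of the two evolution equations
    (∀ T : EReal, 0 < T → ∀ g : ℝ → RiemMetric n X, (∀ t ∈ timeInterval T, g t ∈ SigmaK K g₀) →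
      (IsSolitonRicciFlow Ω (timeInterval T) g ↔
        IsPorousMediumFlow Ω g₀ (timeInterval T) fun t => rootEnd g₀ (g t)) ∧
      (g 0 = g₀ ↔ rootEnd g₀ (g 0) = fun x => ContinuousLinearMap.id ℝ (TangentSpace (𝓡 n) x))) := by
  refine ⟨fun g hg e he y hy => ricChart_eq Ω he hK hg hy,
    fun g hg e he y hy => ricStarChart_eq Ω he hK hg hy, bijOn_rootEnd hK,
    fun T hT g hg => ⟨?_, eq_iff_rootEnd_eq_id⟩⟩
  exact isSolitonRicciFlow_iff (convex_timeInterval T) (interior_timeInterval_nonempty hT) hK hg
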